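/- Let $\alpha \geq 0$, $\beta \geq 0$, $0 \leq \nu < 3$, $\nu \leq 2\beta$ and $\gamma \geq (3-\nu)/4$. Then there is a constant $C = C(\alpha,\beta,\nu,\gamma) > 0$ such that the following holds for every non-negative function $V$ on $(0,\infty)$ for which $V(x)^{\gamma + (1+\nu)/4}\, x^{\nu}$ is integrable on $(0,\infty)$. The quadratic form $$ u \mapsto \int_0^\infty \left( \left| \frac{d}{dx}\left( \frac{1}{x^\alpha} \frac{d}{dx}\left(\frac{u(x)}{x^\beta}\right)\right)\right|^2 x^{2(\alpha+\beta)} - V(x)|u(x)|^2 \right) dx , $$ defined on the complex-valued functions $u \in C_0^\infty(0,\infty)$, is lower semibounded and closable in $L^2(0,\infty)$. Let $H_0 - V$ be the self-adjoint operator in $L^2(0,\infty)$ associated with the closure of this form. The negative spectrum of $H_0 - V$ is discrete, that is, every negative point of the spectrum is an isolated point of the spectrum and an eigenvalue of finite multiplicity, and $$ \operatorname{tr}(H_0-V)_-^{\gamma} \leq C \int_0^\infty V(x)^{\gamma + \frac{1+\nu}{4}}\, x^{\nu}\, dx , $$ where $\operatorname{tr}(H_0-V)_-^{\gamma}$ denotes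 the sum of $|\lambda|^\gamma$ over the negative eigenvalues $\lambda$ of $H_0-V$, counted with multiplicity. -/

import Mathlib

open MeasureTheory Filter Topology Set
open scoped ENNReal Distributions

noncomputable section

section AbstractForms

/-! Quadratic forms `q` on a complex vector space `D` that is embedded in a Hilbert space `H`
by a linear map `j`. -/

variable {H : Type*} [NormedAddCommGroup H] [InnerProductSpace ℂ H]
variable {D : Type*} [AddCommGroup D] [Module ℂ D]

/-- `q` is lower semibounded: `q[u] ≥ m ‖u‖²` for some real `m` and all `u`. -/
def FormSemibounded (j : D →ₗ[ℂ] H) (q : D → ℝ) : Prop :=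
  ∃ m : ℝ, ∀ u : D, m * ‖j u‖ ^ 2 ≤ q u

/-- The sequence `s` in `D` is `q`-convergent to `u`:
`s n → u` in `H`, and `q[s n - s m] → 0` as `n, m → ∞`. -/
def FormConverges (j : D →ₗ[ℂ] H) (q : D → ℝ) (s : ℕ → D) (u : H) : Prop :=
  Tendsto (fun n => j (s n)) atTop (𝓝 u) ∧
    Tendsto (fun p : ℕ × ℕ => q (s p.1 - s p.2)) atTop (𝓝 0)

/-- `q` is closable: `q[s n] → 0` whenever `s` is `q`-convergent to `0`. -/
def FormClosable (j : D →ₗ[ℂ] H) (q : D → ℝ) : Prop :=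
  ∀ s : ℕ → D, FormConverges j q s 0 → Tendsto (fun n => q (s n)) atTop (𝓝 0)

/-- The sesquilinear form `b` with domain `Q` is the closure of `q`: its domain consists of the
limits of `q`-convergent sequences, and `b[u] = lim q[s n]` whenever `s` is `q`-convergent to `u`.
By polarization the values on the diagonal determine `b`. -/
structure IsFormClosure (j : D →ₗ[ℂ] H) (q : D → ℝ)
    (Q : Submodule ℂ H) (b : Q →ₗ⋆[ℂ] Q →ₗ[ℂ] ℂ) : Prop where
  mem_domain_iff : ∀ u : H, u ∈ Q ↔ ∃ s : ℕ → D, FormConverges j q s u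
  tendsto_diag : ∀ (u : Q) (s : ℕ → D), FormConverges j q s u →
    Tendsto (fun n => (q (s n) : ℂ)) atTop (𝓝 (b u u))

/-- `A` is the operator associated with the form `b` with domain `Q`: a vector `u` lies in the
domain of `A` with `A u = f` exactly when `u ∈ Q` and `b(u, v) = ⟨f, v⟩` for all `v ∈ Q`. -/
def IsFormOperator (Q : Submodule ℂ H) (b : Q →ₗ⋆[ℂ] Q →ₗ[ℂ] ℂ) (A : H →ₗ.[ℂ] H) : Prop :=
  ∀ u f : H, (u, f) ∈ A.graph ↔ ∃ hu : u ∈ Q, ∀ v : Q, b ⟨u, hu⟩ v = inner ℂ f (v : H)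

end AbstractForms

section UnboundedSpectrum

variable {H : Type*} [NormedAddCommGroup H] [InnerProductSpace ℂ H]

/-- The resolvent set of an unbounded operator: the `z` for which `A - z`, from the domain of `A`
to `H`, has a bounded everywhere defined two-sided inverse `R`. -/
def pmapResolventSet (A : H →ₗ.[ℂ] H) : Set ℂ :=
  {z | ∃ R : H →L[ℂ] H,
    (∀ f : H, ∃ h : R f ∈ A.domain, A ⟨R f, h⟩ - z • R f = f) ∧
    (∀ u : A.domain, R (A u - z • (u : H)) = u)}

/-- The spectrum of an unbounded operator. -/
def pmapSpectrum (A : H →ₗ.[ℂ] H) : Set ℂ := (pmapResolventSet A)ᶜ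

/-- The eigenspace `{u ∈ dom A : A u = z u}`. -/
def pmapEigenspace (A : H →ₗ.[ℂ] H) (z : ℂ) : Submodule ℂ H where
  carrier := {u | (u, z • u) ∈ A.graph}
  add_mem' {u v} hu hv := by
    have h := A.graph.add_mem hu hv
    rwa [Prod.mk_add_mk, ← smul_add] at h
  zero_mem' := by
    have h : ((0 : H), (0 : H)) ∈ A.graph := A.graph.zero_mem
    rwa [mem_ofPred_eq, smul_zero]
  smul_mem' c u hu := by
    have h := A.graph.smul_mem c hu
    rwa [Prod.smul_mk, smul_comm] at h

/-- The negative spectrum of `A` is discrete: every spectral point `l < 0` is an isolated point of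
the spectrum and an eigenvalue of finite multiplicity. -/
def DiscreteNegativeSpectrum (A : H →ₗ.[ℂ] H) : Prop :=
  ∀ l : ℝ, l < 0 → (l : ℂ) ∈ pmapSpectrum A →
    (∃ ε > 0, ∀ z ∈ pmapSpectrum A, dist z (l : ℂ) < ε → z = l) ∧
    pmapEigenspace A l ≠ ⊥ ∧ FiniteDimensional ℂ (pmapEigenspace A l)

/-- `tr A_-^γ`, the sum of `|l|^γ` over the negative eigenvalues `l` of `A`, each counted with its
multiplicity. (A number `l` that is not an eigenvalue has multiplicity zero.) -/
def traceNegPow (A : H →ₗ.[ℂ] H) (γ : ℝ) : ℝ≥0∞ :=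
  ∑' l : Iio (0 : ℝ),
    ((Cardinal.toENat (Module.rank ℂ (pmapEigenspace A ((l : ℝ) : ℂ))) : ℕ∞) : ℝ≥0∞) *
      ENNReal.ofReal (|(l : ℝ)| ^ γ)

end UnboundedSpectrum

section HalfLine

/-- The open half-line `(0, ∞)`. -/
def halfLine : TopologicalSpace.Opens ℝ := ⟨Ioi 0, isOpen_Ioi⟩

/-- The Hilbert space `L²(0, ∞)` of complex-valued functions. -/
abbrev L2HalfLine : Type := Lp ℂ 2 (volume.restrict (Ioi (0 : ℝ)))

theorem testFunction_memLp (u : 𝓓(halfLine, ℂ)) :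
    MemLp (u : ℝ → ℂ) 2 (volume.restrict (Ioi (0 : ℝ))) :=
  u.continuous.memLp_of_hasCompactSupport u.hasCompactSupport

/-- The embedding of `C₀^∞(0, ∞)` into `L²(0, ∞)`. -/
def testToL2 : 𝓓(halfLine, ℂ) →ₗ[ℂ] L2HalfLine where
  toFun u := (testFunction_memLp u).toLp u
  map_add' u v := MemLp.toLp_add (testFunction_memLp u) (testFunction_memLp v)
  map_smul' c u := MemLp.toLp_const_smul c (testFunction_memLp u)

/-- The differential expression `(x^{-α} (u / x^β)')'`. -/
def weightedSecondDeriv (α β : ℝ) (u : ℝ → ℂ) (x : ℝ) : ℂ :=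
  deriv (fun y : ℝ => (1 / y ^ α) • deriv (fun t : ℝ => (1 / t ^ β) • u t) y) x

/-- The quadratic form
`u ↦ ∫₀^∞ (|(x^{-α} (u / x^β)')'|² x^{2(α+β)} - V(x) |u(x)|²) dx` on `C₀^∞(0, ∞)`. -/
def halfLineForm (α β : ℝ) (V : ℝ → ℝ) (u : 𝓓(halfLine, ℂ)) : ℝ :=
  ∫ x in Ioi (0 : ℝ),
    (‖weightedSecondDeriv α β u x‖ ^ 2 * x ^ (2 * (α + β)) - V x * ‖u x‖ ^ 2)

end HalfLine

end

/-!
Cut the half-line at points `0 = t₀ < t₁ < ⋯` so that every interval carries at most a fixed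
scale-invariant mass `l_k^{4γ} ∫ V^p x^ν`, where `l_k = t_{k+1} - t_k` and `p = γ + (1 + ν) / 4`,
while the sum of `l_k^{-4γ}` is bounded by a multiple of `∫ V^p x^ν + δ`. By a Sobolev inequality
on each interval, `V` is dominated there by the energy plus `l_k^{-4} ‖u‖²`, and by the energy alone
if the two Cauchy data of `u` at `t_{k+1}` vanish. Hence for `E > 0` the form is at least
`-E ‖u‖²` on a subspace of codimension at most `2 #{k : l_k^{-4} > E}`, so that the negative
eigenvalues are dominated by the numbers `-l_k^{-4}`, each taken twice.

If `π` embeds the completion of the test functions in a form norm into `L²`, then `π π†` is the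
resolvent of the form operator at a point below the spectrum, so all spectral statements reduce to
this bounded operator.
-/

noncomputable section

section UpperIndex

open Module

variable {H : Type*} [NormedAddCommGroup H] [InnerProductSpace ℂ H]

theorem re_inner_ofReal_smul_self (a : ℝ) (v : H) :
    (inner ℂ ((a : ℂ) • v) v).re = a * ‖v‖ ^ 2 := by
  rw [inner_smul_left, Complex.conj_ofReal, Complex.re_ofReal_mul, inner_self_eq_norm_sq_to_K,
    ← RCLike.ofReal_pow]
  exact congrArg (a * ·) (Complex.ofReal_re _)

/-- The quadratic form of `T - c` is positive definite on `W`. -/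
def ExceedsOn (T : H →L[ℂ] H) (c : ℝ) (W : Submodule ℂ H) : Prop :=
  ∀ u ∈ W, u ≠ 0 → c * ‖u‖ ^ 2 < (inner ℂ (T u) u).re

/-- The number of spectral points of `T` above `c`, counted with multiplicity as in Glazman's
lemma, is at most `n`: subspaces on which the form of `T` exceeds `c` have dimension at most `n`. -/
def UpperIndexLE (T : H →L[ℂ] H) (c : ℝ) (n : ℕ) : Prop :=
  ∀ W : Submodule ℂ H, FiniteDimensional ℂ W → ExceedsOn T c W → finrank ℂ W ≤ n

variable {T : H →L[ℂ] H} {c : ℝ} {n : ℕ}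

theorem exceedsOn_eigenspace {l : ℝ} (hl : c < l) :
    ExceedsOn T c (End.eigenspace (T : H →ₗ[ℂ] H) (l : ℂ)) := by
  intro u hu hu0
  rw [← ContinuousLinearMap.coe_coe, End.mem_eigenspace_iff.1 hu, re_inner_ofReal_smul_self]
  exact mul_lt_mul_of_pos_right hl (by positivity)

theorem UpperIndexLE.finiteDimensional (h : UpperIndexLE T c n) {W : Submodule ℂ H}
    (hW : ExceedsOn T c W) : FiniteDimensional ℂ W := by
  rw [FiniteDimensional, ← Module.rank_lt_aleph0_iff]
  by_contra! hinf
  have hn : ((n + 1 : ℕ) : Cardinal) ≤ Module.rank ℂ W := (Cardinal.natCast_lt_aleph0).le.trans hinf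
  obtain ⟨f, hf⟩ := Module.le_rank_iff_exists_linearMap.1 hn
  have hinj : Function.Injective (W.subtype ∘ₗ f) := W.injective_subtype.comp hf
  have hle : finrank ℂ (LinearMap.range (W.subtype ∘ₗ f)) ≤ n :=
    h _ inferInstance fun u ⟨x, hx⟩ hu => hW u (hx ▸ (f x).2) hu
  rw [LinearMap.finrank_range_of_inj hinj, Module.finrank_fin_fun] at hle
  exact absurd hle (Nat.not_succ_le_self n)

/-- The bounded operator `√((T - c)₊)`. -/
def sqrtPosPartSub [CompleteSpace H] (T : H →L[ℂ] H) (c : ℝ) : H →L[ℂ] H :=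
  cfc (fun t : ℝ => √(t - c)) T

section Eigenvectors

variable [CompleteSpace H]

theorem isSelfAdjoint_sqrtPosPartSub (T : H →L[ℂ] H) (c : ℝ) :
    IsSelfAdjoint (sqrtPosPartSub T c) :=
  cfc_predicate _ T

-- Pointwise, `(t - c) √((t - c)₊) = √((t - c)₊) ^ 3`.
theorem apply_sqrtPosPartSub (hT : IsSelfAdjoint T) (v : H) :
    T (sqrtPosPartSub T c v) = (c : ℂ) • sqrtPosPartSub T c v +
      sqrtPosPartSub T c (sqrtPosPartSub T c (sqrtPosPartSub T c v)) := by
  have hpoint : (fun t : ℝ => t * √(t - c)) =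
      fun t => c • √(t - c) + √(t - c) * (√(t - c) * √(t - c)) := by
    ext t
    rcases le_total c t with hct | htc
    · rw [Real.mul_self_sqrt (sub_nonneg.2 hct), smul_eq_mul]
      ring
    · rw [Real.sqrt_eq_zero_of_nonpos (sub_nonpos.2 htc)]
      simp
  have hcfc := congrArg (cfc · T) hpoint
  rw [cfc_mul _ _ T, cfc_id' ℝ T, cfc_add _ _ _, cfc_smul _ _ _, cfc_mul _ _ T, cfc_mul _ _ T]
    at hcfc
  exact congrArg (fun S : H →L[ℂ] H => S v) hcfc

theorem exceedsOn_range_sqrtPosPartSub (hT : IsSelfAdjoint T) :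
    ExceedsOn T c (LinearMap.range (sqrtPosPartSub T c : H →ₗ[ℂ] H)) := by
  set S := sqrtPosPartSub T c with hS
  have hsym : ∀ x y : H, inner ℂ (S x) y = inner ℂ x (S y) :=
    (isSelfAdjoint_sqrtPosPartSub T c).isSymmetric
  rintro _ ⟨v, rfl⟩ hv
  rw [ContinuousLinearMap.coe_coe] at hv ⊢
  have hSv : S (S v) ≠ 0 := fun h0 => hv <| inner_self_eq_zero.1 <| by
    rw [hsym, h0, inner_zero_right]
  have hcube : (inner ℂ (S (S (S v))) (S v)).re = ‖S (S v)‖ ^ 2 := by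
    rw [hsym, inner_self_eq_norm_sq_to_K, ← RCLike.ofReal_pow]
    exact Complex.ofReal_re _
  rw [apply_sqrtPosPartSub hT, inner_add_left, Complex.add_re, re_inner_ofReal_smul_self, ← hS,
    hcube]
  exact lt_add_of_pos_right _ (by positivity)

theorem UpperIndexLE.isCompactOperator_sqrtPosPartSub (h : UpperIndexLE T c n)
    (hT : IsSelfAdjoint T) : IsCompactOperator (sqrtPosPartSub T c) := by
  have := h.finiteDimensional (exceedsOn_range_sqrtPosPartSub hT)
  have := FiniteDimensional.proper ℂ (LinearMap.range (sqrtPosPartSub T c : H →ₗ[ℂ] H))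
  have hrange : IsCompactOperator ((sqrtPosPartSub T c).codRestrict
      (LinearMap.range (sqrtPosPartSub T c : H →ₗ[ℂ] H)) (LinearMap.mem_range_self _)) :=
    isCompactOperator_of_locallyCompactSpace_dom _
  exact hrange.clm_comp (Submodule.subtypeL _)

theorem UpperIndexLE.eigenspace_ne_bot (h : UpperIndexLE T c n) (hT : IsSelfAdjoint T)
    {l : ℝ} (hcl : c < l) (hl : (l : ℂ) ∈ spectrum ℂ T) :
    End.eigenspace (T : H →ₗ[ℂ] H) (l : ℂ) ≠ ⊥ := by
  set S := sqrtPosPartSub T c with hS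
  set s := √(l - c) with hs
  have hs0 : (s : ℂ) ≠ 0 := Complex.ofReal_ne_zero.2 (Real.sqrt_pos.2 (sub_pos.2 hcl)).ne'
  have hsS : (s : ℂ) ∈ spectrum ℂ S := by
    refine (spectrum.algebraMap_mem_iff (R := ℝ) ℂ).2 ?_
    rw [hS, sqrtPosPartSub, cfc_map_spectrum _ T]
    exact mem_image_of_mem _ ((spectrum.algebraMap_mem_iff (R := ℝ) ℂ).1 hl)
  obtain ⟨v, hv⟩ := (((h.isCompactOperator_sqrtPosPartSub hT).hasEigenvalue_iff_mem_spectrum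
    hs0).2 hsS).exists_hasEigenvector
  have hSv : S v = (s : ℂ) • v := hv.apply_eq_smul
  refine (Submodule.ne_bot_iff _).2 ⟨v, End.mem_eigenspace_iff.2 ?_, hv.2⟩
  have hTSv := apply_sqrtPosPartSub (c := c) hT v
  rw [← hS] at hTSv
  simp only [hSv, map_smul, smul_smul] at hTSv
  have hss : (s : ℂ) * s = (l : ℂ) - c := by
    rw [← Complex.ofReal_mul, hs, Real.mul_self_sqrt (sub_nonneg.2 hcl.le), Complex.ofReal_sub]
  rw [hss, ← add_smul] at hTSv
  refine smul_right_injective H hs0 ?_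
  change (s : ℂ) • T v = (s : ℂ) • (l : ℂ) • v
  rw [hTSv, smul_smul]
  congr 1
  ring

end Eigenvectors

section EigenvalueCount

theorem norm_sum_eigenvectors_sq {T : H →ₗ[ℂ] H} (hT : T.IsSymmetric) {ι : Type*} [Fintype ι]
    {l : ι → ℝ} (hl : Function.Injective l) (v : ∀ i, End.eigenspace T (l i : ℂ)) :
    ‖∑ i, (v i : H)‖ ^ 2 = ∑ i, ‖v i‖ ^ 2 :=
  (hT.orthogonalFamily_eigenspaces.comp (Complex.ofReal_injective.comp hl)).norm_sum v Finset.univ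

theorem re_inner_sum_eigenvectors {T : H →ₗ[ℂ] H} (hT : T.IsSymmetric) {ι : Type*} [Fintype ι]
    {l : ι → ℝ} (hl : Function.Injective l) (v : ∀ i, End.eigenspace T (l i : ℂ)) :
    (inner ℂ (T (∑ i, (v i : H))) (∑ i, (v i : H))).re = ∑ i, l i * ‖v i‖ ^ 2 := by
  have hTv : T (∑ i, (v i : H)) =
      ∑ i, (((l i : ℂ) • v i : End.eigenspace T (l i : ℂ)) : H) := by
    rw [map_sum]
    exact Finset.sum_congr rfl fun i _ => End.mem_eigenspace_iff.1 (v i).2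
  have horth := (hT.orthogonalFamily_eigenspaces.comp
    (Complex.ofReal_injective.comp hl)).inner_sum (fun i => (l i : ℂ) • v i) v Finset.univ
  rw [hTv]
  refine (congrArg Complex.re horth).trans ?_
  rw [Complex.re_sum]
  exact Finset.sum_congr rfl fun i _ => re_inner_ofReal_smul_self (l i) (v i)

theorem UpperIndexLE.sum_finrank_eigenspace_le (h : UpperIndexLE T c n)
    (hT : (T : H →ₗ[ℂ] H).IsSymmetric) {ι : Type*} [Fintype ι] {l : ι → ℝ}
    (hinj : Function.Injective l) (hl : ∀ i, c < l i) :
    ∑ i, finrank ℂ (End.eigenspace (T : H →ₗ[ℂ] H) (l i : ℂ)) ≤ n := by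
  have (i : ι) : FiniteDimensional ℂ (End.eigenspace (T : H →ₗ[ℂ] H) (l i : ℂ)) :=
    h.finiteDimensional (exceedsOn_eigenspace (hl i))
  let sumMap : (Π i, End.eigenspace (T : H →ₗ[ℂ] H) (l i : ℂ)) →ₗ[ℂ] H :=
    ∑ i, Submodule.subtype _ ∘ₗ LinearMap.proj i
  have hsum (v) : sumMap v = ∑ i, (v i : H) := by simp [sumMap]
  have hsumMap_inj : Function.Injective sumMap := by
    refine (injective_iff_map_eq_zero sumMap).2 fun v hv => funext fun i => ?_
    have hnorm := norm_sum_eigenvectors_sq hT hinj v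
    rw [← hsum, hv, norm_zero, zero_pow two_ne_zero, eq_comm,
      Finset.sum_eq_zero_iff_of_nonneg fun i _ => by positivity] at hnorm
    simpa using hnorm i (Finset.mem_univ i)
  have hexceeds : ExceedsOn T c (LinearMap.range sumMap) := by
    rintro _ ⟨v, rfl⟩ hv
    obtain ⟨i, hi⟩ := Function.ne_iff.1 (fun hv0 : v = 0 => hv (by rw [hv0, map_zero]))
    rw [hsum, norm_sum_eigenvectors_sq hT hinj, ← ContinuousLinearMap.coe_coe,
      re_inner_sum_eigenvectors hT hinj, Finset.mul_sum]
    exact Finset.sum_lt_sum (fun j _ => mul_le_mul_of_nonneg_right (hl j).le (by positivity))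
      ⟨i, Finset.mem_univ i, mul_lt_mul_of_pos_right (hl i) (pow_pos (norm_pos_iff.2 hi) 2)⟩
  have hle := h _ inferInstance hexceeds
  rwa [LinearMap.finrank_range_of_inj hsumMap_inj, Module.finrank_pi_fintype] at hle

theorem UpperIndexLE.finite_spectrum_gt [CompleteSpace H] (h : UpperIndexLE T c n)
    (hT : IsSelfAdjoint T) : {l : ℝ | (l : ℂ) ∈ spectrum ℂ T ∧ c < l}.Finite := by
  by_contra hinf
  obtain ⟨F, hF, hcard⟩ := Set.Infinite.exists_subset_card_eq hinf (n + 1)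
  have hdim (l : F) : 1 ≤ finrank ℂ (End.eigenspace (T : H →ₗ[ℂ] H) (l : ℂ)) := by
    have := h.finiteDimensional (exceedsOn_eigenspace (hF l.2).2)
    exact Nat.one_le_iff_ne_zero.2 fun h0 =>
      h.eigenspace_ne_bot hT (hF l.2).2 (hF l.2).1 (Submodule.finrank_eq_zero.1 h0)
  have hcount := (Finset.sum_le_sum fun l _ => hdim l).trans
    (h.sum_finrank_eigenspace_le hT.isSymmetric Subtype.val_injective fun l : F => (hF l.2).2)
  rw [Finset.sum_const, Finset.card_univ, Fintype.card_coe, hcard, smul_eq_mul, mul_one] at hcount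
  exact absurd hcount (Nat.not_succ_le_self n)

end EigenvalueCount

end UpperIndex

section InvSubConst

open Module

variable {H : Type*} [NormedAddCommGroup H] [InnerProductSpace ℂ H]

/-- The unbounded operator `R⁻¹ - m`, i.e. the operator whose resolvent at `-m` is `R`. It is
defined through its graph `{(R g, g - m • R g)}`, which is single-valued when `R` is injective. -/
def invSubConst (R : H →L[ℂ] H) (m : ℝ) : H →ₗ.[ℂ] H :=
  (LinearMap.range ((R : H →ₗ[ℂ] H).prod
    (LinearMap.id - (m : ℂ) • (R : H →ₗ[ℂ] H)))).toLinearPMap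

variable {R : H →L[ℂ] H} {m : ℝ}

theorem mem_invSubConst_graph (hinj : Function.Injective R) {u f : H} :
    (u, f) ∈ (invSubConst R m).graph ↔ R (f + (m : ℂ) • u) = u := by
  rw [invSubConst, Submodule.toLinearPMap_graph_eq]
  · constructor
    · rintro ⟨g, hg⟩
      obtain ⟨rfl, rfl⟩ := Prod.mk.inj hg
      exact congrArg R (sub_add_cancel g _)
    · intro h
      refine ⟨f + (m : ℂ) • u, Prod.ext h ?_⟩
      change f + (m : ℂ) • u - (m : ℂ) • R (f + (m : ℂ) • u) = f
      rw [h, add_sub_cancel_right]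
  · rintro _ ⟨g, rfl⟩ hg
    have hg0 : g = 0 := hinj (Eq.trans hg (map_zero R).symm)
    rw [hg0, map_zero, Prod.snd_zero]

theorem apply_mem_invSubConst_graph (hinj : Function.Injective R) (g : H) :
    (R g, g - (m : ℂ) • R g) ∈ (invSubConst R m).graph := by
  rw [mem_invSubConst_graph hinj, sub_add_cancel]

theorem pmapEigenspace_invSubConst (hinj : Function.Injective R) {z : ℂ} (hz : z + m ≠ 0) :
    pmapEigenspace (invSubConst R m) z = End.eigenspace (R : H →ₗ[ℂ] H) (z + m)⁻¹ := by
  ext u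
  rw [End.mem_eigenspace_iff]
  change (u, z • u) ∈ (invSubConst R m).graph ↔ _
  rw [mem_invSubConst_graph hinj, ← add_smul, map_smul, ContinuousLinearMap.coe_coe]
  exact (eq_inv_smul_iff₀ hz).symm

theorem mem_pmapResolventSet_of_mem_graph {A : H →ₗ.[ℂ] H} {z : ℂ} (S : H →L[ℂ] H)
    (hright : ∀ f, (S f, f + z • S f) ∈ A.graph)
    (hleft : ∀ u f, (u, f) ∈ A.graph → S (f - z • u) = u) : z ∈ pmapResolventSet A := by
  refine ⟨S, fun f => ?_, fun u => hleft _ _ (A.mem_graph u)⟩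
  have hdom := LinearPMap.mem_domain_of_mem_graph (hright f)
  refine ⟨hdom, ?_⟩
  rw [← (LinearPMap.image_iff hdom).2 (hright f)]
  exact add_sub_cancel_right f _

theorem neg_mem_pmapResolventSet_invSubConst (hinj : Function.Injective R) :
    (-m : ℂ) ∈ pmapResolventSet (invSubConst R m) :=
  mem_pmapResolventSet_of_mem_graph R
    (fun f => by simpa [sub_eq_add_neg] using apply_mem_invSubConst_graph hinj f)
    fun u f huf => by simpa using (mem_invSubConst_graph hinj).1 huf

theorem mem_pmapResolventSet_invSubConst (hinj : Function.Injective R) {z : ℂ}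
    (hz : z + m ≠ 0) (hR : (z + m)⁻¹ ∉ spectrum ℂ R) :
    z ∈ pmapResolventSet (invSubConst R m) := by
  obtain ⟨X, hX⟩ := spectrum.notMem_iff.1 hR
  have hXapp (v : H) : (z + m) • (X : H →L[ℂ] H) v = v - (z + m) • R v := by
    rw [hX]
    simp [Algebra.algebraMap_eq_smul_one, smul_sub, smul_inv_smul₀ hz]
  have hXY (v : H) : (X : H →L[ℂ] H) ((X⁻¹).val v) = v :=
    congrArg (fun T : H →L[ℂ] H => T v) X.mul_inv
  have hYX (v : H) : (X⁻¹).val ((X : H →L[ℂ] H) v) = v :=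
    congrArg (fun T : H →L[ℂ] H => T v) X.inv_mul
  -- `(R⁻¹ - m - z)⁻¹ = R (1 - (z + m) R)⁻¹`, and `X = (z + m)⁻¹ - R`
  refine mem_pmapResolventSet_of_mem_graph ((z + m)⁻¹ • R.comp (X⁻¹).val) (fun f => ?_)
    fun u f huf => ?_
  · have hgraph := apply_mem_invSubConst_graph (m := m) hinj ((z + m)⁻¹ • (X⁻¹).val f)
    have hf := hXapp ((z + m)⁻¹ • (X⁻¹).val f)
    rw [map_smul, hXY, smul_inv_smul₀ hz] at hf
    have hRf : ((z + m)⁻¹ • R.comp (X⁻¹).val) f = R ((z + m)⁻¹ • (X⁻¹).val f) :=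
      (map_smul R _ _).symm
    rw [hRf, show f + z • R ((z + m)⁻¹ • (X⁻¹).val f) = (z + m)⁻¹ • (X⁻¹).val f -
      (m : ℂ) • R ((z + m)⁻¹ • (X⁻¹).val f) by nth_rewrite 1 [hf]; module]
    exact hgraph
  · have hu := (mem_invSubConst_graph hinj).1 huf
    have hsplit : f - z • u = (z + m) • (X : H →L[ℂ] H) (f + (m : ℂ) • u) := by
      rw [hXapp, hu, add_smul]
      abel
    change (z + m)⁻¹ • R ((X⁻¹).val (f - z • u)) = u
    rw [hsplit, map_smul, hYX, map_smul, inv_smul_smul₀ hz, hu]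

theorem inv_add_mem_spectrum_of_mem_pmapSpectrum (hinj : Function.Injective R) {z : ℂ}
    (hz : z ∈ pmapSpectrum (invSubConst R m)) : z + m ≠ 0 ∧ (z + m)⁻¹ ∈ spectrum ℂ R := by
  have hzm : z + m ≠ 0 := fun h =>
    hz (eq_neg_of_add_eq_zero_left h ▸ neg_mem_pmapResolventSet_invSubConst hinj)
  exact ⟨hzm, not_not.1 fun hs => hz (mem_pmapResolventSet_invSubConst hinj hzm hs)⟩

section SelfAdjoint

variable [CompleteSpace H]

theorem dense_domain_invSubConst (hR : IsSelfAdjoint R) (hinj : Function.Injective R) :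
    Dense ((invSubConst R m).domain : Set H) := by
  rw [Submodule.dense_iff_topologicalClosure_eq_top, Submodule.topologicalClosure_eq_top_iff,
    Submodule.eq_bot_iff]
  refine fun y hy => hinj (ext_inner_left ℂ fun f => ?_)
  have hRf := LinearPMap.mem_domain_of_mem_graph (apply_mem_invSubConst_graph (m := m) hinj f)
  calc inner ℂ f (R y) = inner ℂ (R f) y := (hR.isSymmetric f y).symm
    _ = inner ℂ f (R 0) := by rw [hy _ hRf, map_zero, inner_zero_right]

theorem isSelfAdjoint_invSubConst (hR : IsSelfAdjoint R) (hinj : Function.Injective R) :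
    IsSelfAdjoint (invSubConst R m) := by
  rw [LinearPMap.isSelfAdjoint_def]
  refine LinearPMap.eq_of_eq_graph ?_
  rw [LinearPMap.adjoint_graph_eq_graph_adjoint (dense_domain_invSubConst hR hinj)]
  ext ⟨y, w⟩
  rw [Submodule.mem_adjoint_iff, mem_invSubConst_graph hinj]
  have hpair (f : H) : inner ℂ (f - (m : ℂ) • R f) y - inner ℂ (R f) w =
      inner ℂ f y - inner ℂ f (R (w + (m : ℂ) • y)) := by
    have hsym : inner ℂ (R f) (w + (m : ℂ) • y) = inner ℂ f (R (w + (m : ℂ) • y)) :=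
      hR.isSymmetric _ _
    rw [← hsym, inner_add_right, inner_sub_left, inner_smul_left, inner_smul_right,
      Complex.conj_ofReal]
    ring
  constructor
  · refine fun h => ext_inner_left ℂ fun f => ?_
    have hf := h _ _ (apply_mem_invSubConst_graph (m := m) hinj f)
    rw [hpair] at hf
    exact (sub_eq_zero.1 hf).symm
  · intro h a b hab
    have hf := hpair (b + (m : ℂ) • a)
    rwa [(mem_invSubConst_graph hinj).1 hab, add_sub_cancel_right, h, sub_self] at hf

open scoped ComplexOrder in
theorem exists_ofReal_eq_of_mem_pmapSpectrum (hR : R.IsPositive) (hinj : Function.Injective R)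
    {z : ℂ} (hz : z ∈ pmapSpectrum (invSubConst R m)) : ∃ l : ℝ, z = l ∧ 0 < l + m := by
  obtain ⟨hzm, hs⟩ := inv_add_mem_spectrum_of_mem_pmapSpectrum hinj hz
  have hpos : 0 < z + m := lt_of_le_of_ne
    (inv_nonneg.1 (spectrum_nonneg_of_nonneg (R.nonneg_iff_isPositive.2 hR) hs)) hzm.symm
  obtain ⟨hre, him⟩ := Complex.pos_iff.1 hpos
  refine ⟨z.re, Complex.ext rfl ?_, by simpa using hre⟩
  simpa using him.symm

section Discrete

variable {E : ℝ} {n : ℕ}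

theorem UpperIndexLE.finite_pmapSpectrum_lt (h : UpperIndexLE R (m - E)⁻¹ n)
    (hR : R.IsPositive) (hinj : Function.Injective R) :
    {l : ℝ | (l : ℂ) ∈ pmapSpectrum (invSubConst R m) ∧ l < -E}.Finite := by
  refine Set.Finite.of_injOn (f := fun l => (l + m)⁻¹) (fun l hl => ?_) (fun a _ b _ hab => ?_)
    (h.finite_spectrum_gt hR.isSelfAdjoint)
  · obtain ⟨-, hs⟩ := inv_add_mem_spectrum_of_mem_pmapSpectrum hinj hl.1
    obtain ⟨k, hk, hkm⟩ := exists_ofReal_eq_of_mem_pmapSpectrum hR hinj hl.1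
    obtain rfl := Complex.ofReal_injective hk
    exact ⟨by simpa using hs, inv_strictAnti₀ hkm (by linarith [hl.2])⟩
  · simpa using hab

theorem UpperIndexLE.isolated_of_mem_pmapSpectrum (h : UpperIndexLE R (m - E)⁻¹ n)
    (hR : R.IsPositive) (hinj : Function.Injective R) {l : ℝ} (hl : l < -E) :
    ∃ ε > 0, ∀ z ∈ pmapSpectrum (invSubConst R m), dist z (l : ℂ) < ε → z = l := by
  set s : Set ℝ := {k : ℝ | (k : ℂ) ∈ pmapSpectrum (invSubConst R m) ∧ k < -E}
  have hopen : Iio (-E) ∩ (s \ {l})ᶜ ∈ 𝓝 l :=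
    (isOpen_Iio.inter ((h.finite_pmapSpectrum_lt hR hinj).subset sdiff_subset
      ).isClosed.isOpen_compl).mem_nhds ⟨hl, by simp⟩
  obtain ⟨ε, hε, hball⟩ := Metric.mem_nhds_iff.1 hopen
  refine ⟨ε, hε, fun z hz hd => ?_⟩
  obtain ⟨k, rfl, -⟩ := exists_ofReal_eq_of_mem_pmapSpectrum hR hinj hz
  rw [Complex.dist_of_im_eq (by simp), Complex.ofReal_re, Complex.ofReal_re] at hd
  obtain ⟨hkE, hk⟩ := hball (Metric.mem_ball.2 hd)
  exact congrArg Complex.ofReal (not_not.1 fun hkl => hk ⟨⟨hz, hkE⟩, hkl⟩)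

end Discrete

theorem discreteNegativeSpectrum_invSubConst (hR : R.IsPositive) (hinj : Function.Injective R)
    (hindex : ∀ E : ℝ, 0 < E → E < m → ∃ n, UpperIndexLE R (m - E)⁻¹ n) :
    DiscreteNegativeSpectrum (invSubConst R m) := by
  intro l hl hls
  obtain ⟨hlm0, hlR⟩ := inv_add_mem_spectrum_of_mem_pmapSpectrum hinj hls
  obtain ⟨k, hk, hlm⟩ := exists_ofReal_eq_of_mem_pmapSpectrum hR hinj hls
  obtain rfl := Complex.ofReal_injective hk
  obtain ⟨n, hn⟩ := hindex (-l / 2) (by linarith) (by linarith)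
  have hgt : (m - -l / 2)⁻¹ < (l + m)⁻¹ := inv_strictAnti₀ hlm (by linarith)
  refine ⟨hn.isolated_of_mem_pmapSpectrum hR hinj (by linarith), ?_⟩
  rw [pmapEigenspace_invSubConst hinj hlm0]
  rw [show ((l : ℂ) + m)⁻¹ = (((l + m)⁻¹ : ℝ) : ℂ) by push_cast; rfl] at hlR ⊢
  exact ⟨hn.eigenspace_ne_bot hR.isSelfAdjoint hgt hlR,
    hn.finiteDimensional (exceedsOn_eigenspace hgt)⟩

end SelfAdjoint

end InvSubConst

section FormModel

open Module ContinuousLinearMap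

variable {H : Type*} [NormedAddCommGroup H] [InnerProductSpace ℂ H]
variable {G : Type*} [NormedAddCommGroup G] [InnerProductSpace ℂ G]
variable {D : Type*} [AddCommGroup D] [Module ℂ D]

/-- The form `q + m ‖·‖²` is the inner product of the Hilbert space `G`, which contains `D` densely
through `i` and which is continuously embedded in `H` by `p`, extending `j`. Such a `G` is the
domain of the closure of `q`. -/
structure FormModel (j : D →ₗ[ℂ] H) (q : D → ℝ) (m : ℝ) (i : D →ₗ[ℂ] G) (p : G →L[ℂ] H) :
    Prop where
  denseRange : DenseRange i
  injective : Function.Injective p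
  map_eq : ∀ u, p (i u) = j u
  norm_sq : ∀ u, ‖i u‖ ^ 2 = q u + m * ‖j u‖ ^ 2

/-- For an embedding `p : G → H` of Hilbert spaces, the form `⟪x, y⟫ - m ⟪p x, p y⟫` transported to
the range of `p`. -/
def rangeForm (p : G →L[ℂ] H) (hp : Function.Injective p) (m : ℝ) :
    LinearMap.range (p : G →ₗ[ℂ] H) →ₗ⋆[ℂ] LinearMap.range (p : G →ₗ[ℂ] H) →ₗ[ℂ] ℂ :=
  ((innerₛₗ ℂ).comp (LinearEquiv.ofInjective (p : G →ₗ[ℂ] H) hp).symm.toLinearMap).compl₂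
      (LinearEquiv.ofInjective (p : G →ₗ[ℂ] H) hp).symm.toLinearMap -
    (m : ℂ) • innerₛₗ ℂ

theorem rangeForm_apply {p : G →L[ℂ] H} (hp : Function.Injective p) (m : ℝ) (x y : G) :
    rangeForm p hp m ⟨p x, x, rfl⟩ ⟨p y, y, rfl⟩ =
      inner ℂ x y - m * inner ℂ (p x) (p y) := by
  have hsymm (z : G) : (LinearEquiv.ofInjective (p : G →ₗ[ℂ] H) hp).symm ⟨p z, z, rfl⟩ = z :=
    (LinearEquiv.ofInjective (p : G →ₗ[ℂ] H) hp).symm_apply_apply z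
  change inner ℂ ((LinearEquiv.ofInjective (p : G →ₗ[ℂ] H) hp).symm ⟨p x, x, rfl⟩)
    ((LinearEquiv.ofInjective (p : G →ₗ[ℂ] H) hp).symm ⟨p y, y, rfl⟩) - _ = _
  rw [hsymm, hsymm]
  rfl

theorem rangeForm_self {p : G →L[ℂ] H} (hp : Function.Injective p) (m : ℝ) (x : G) :
    rangeForm p hp m ⟨p x, x, rfl⟩ ⟨p x, x, rfl⟩ = (‖x‖ ^ 2 - m * ‖p x‖ ^ 2 : ℝ) := by
  rw [rangeForm_apply, inner_self_eq_norm_sq_to_K, inner_self_eq_norm_sq_to_K]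
  push_cast
  rfl

section Adjoint

variable [CompleteSpace H] [CompleteSpace G] {p : G →L[ℂ] H}

theorem rangeForm_eq_inner_iff (hp : Function.Injective p) (m : ℝ) (x : G) (f : H) :
    (∀ v : LinearMap.range (p : G →ₗ[ℂ] H), rangeForm p hp m ⟨p x, x, rfl⟩ v = inner ℂ f (v : H)) ↔
      adjoint p (f + (m : ℂ) • p x) = x := by
  have hform (y : G) : rangeForm p hp m ⟨p x, x, rfl⟩ ⟨p y, y, rfl⟩ - inner ℂ f (p y) =
      inner ℂ x y - inner ℂ (adjoint p (f + (m : ℂ) • p x)) y := by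
    rw [rangeForm_apply, adjoint_inner_left, inner_add_left, inner_smul_left, Complex.conj_ofReal]
    ring
  constructor
  · refine fun h => ext_inner_right ℂ fun y => ?_
    have hy := hform y
    rw [h ⟨p y, y, rfl⟩, sub_self] at hy
    exact (sub_eq_zero.1 hy.symm).symm
  · rintro h ⟨_, y, rfl⟩
    have hy := hform y
    rw [h, sub_self] at hy
    exact sub_eq_zero.1 hy

theorem isFormOperator_rangeForm (hp : Function.Injective p) (m : ℝ)
    (hR : Function.Injective (p.comp (adjoint p))) :
    IsFormOperator (LinearMap.range (p : G →ₗ[ℂ] H)) (rangeForm p hp m)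
      (invSubConst (p.comp (adjoint p)) m) := by
  intro u f
  rw [mem_invSubConst_graph hR]
  constructor
  · intro h
    obtain ⟨x, rfl⟩ : ∃ x, p x = u := ⟨_, h⟩
    exact ⟨⟨x, rfl⟩, (rangeForm_eq_inner_iff hp m x f).2 (hp h)⟩
  · rintro ⟨⟨x, rfl⟩, h⟩
    exact congrArg p ((rangeForm_eq_inner_iff hp m x f).1 h)

theorem injective_comp_adjoint (hp : DenseRange p) : Function.Injective (p.comp (adjoint p)) := by
  refine (injective_iff_map_eq_zero _).2 fun f hf => ?_
  have hadj : adjoint p f = 0 := by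
    rw [← inner_self_eq_zero (𝕜 := ℂ), adjoint_inner_left, ← comp_apply, hf, inner_zero_right]
  refine hp.eq_zero_of_inner_left ℂ fun x => ?_
  rw [← adjoint_inner_left, hadj, inner_zero_left]

end Adjoint

theorem finrank_quotient_topologicalClosure_map_le {i : D →ₗ[ℂ] G} (hi : DenseRange i)
    (N : Submodule ℂ D) [FiniteDimensional ℂ (D ⧸ N)] :
    FiniteDimensional ℂ (G ⧸ (N.map i).topologicalClosure) ∧
      finrank ℂ (G ⧸ (N.map i).topologicalClosure) ≤ finrank ℂ (D ⧸ N) := by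
  have hclosed : IsClosed ((N.map i).topologicalClosure : Set G) :=
    Submodule.isClosed_topologicalClosure _
  have hmap : N ≤ (N.map i).topologicalClosure.comap i :=
    Submodule.map_le_iff_le_comap.1 (Submodule.le_topologicalClosure _)
  have hsurj : Function.Surjective (N.mapQ (N.map i).topologicalClosure i hmap) := by
    have hdense := (Submodule.mkQ_surjective
      (N.map i).topologicalClosure).denseRange.comp hi continuous_quot_mk
    rw [← range_eq_univ, ← LinearMap.coe_range,
      ← (Submodule.closed_of_finiteDimensional (LinearMap.range _)).closure_eq]
    refine (Dense.mono ?_ hdense).closure_eq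
    rintro _ ⟨u, rfl⟩
    exact ⟨N.mkQ u, rfl⟩
  exact ⟨Module.Finite.of_surjective _ hsurj, LinearMap.finrank_le_finrank_of_surjective hsurj⟩

namespace FormModel

variable {j : D →ₗ[ℂ] H} {q : D → ℝ} {m : ℝ} {i : D →ₗ[ℂ] G} {p : G →L[ℂ] H}

theorem semibounded (M : FormModel j q m i p) : FormSemibounded j q :=
  ⟨-m, fun u => by linarith [M.norm_sq u, sq_nonneg ‖i u‖]⟩

theorem form_eq (M : FormModel j q m i p) (u : D) : q u = ‖i u‖ ^ 2 - m * ‖p (i u)‖ ^ 2 := by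
  rw [M.norm_sq, M.map_eq, add_sub_cancel_right]

theorem denseRange_embedding (M : FormModel j q m i p) (hj : DenseRange j) : DenseRange p :=
  Dense.mono (range_subset_iff.2 fun u => ⟨i u, M.map_eq u⟩) hj

theorem tendsto_form (M : FormModel j q m i p) {ι : Type*} {l : Filter ι} {s : ι → D} {x : G}
    (hs : Tendsto (fun n => i (s n)) l (𝓝 x)) :
    Tendsto (fun n => q (s n)) l (𝓝 (‖x‖ ^ 2 - m * ‖p x‖ ^ 2)) := by
  simp_rw [M.form_eq]
  exact (hs.norm.pow 2).sub ((((p.continuous.tendsto x).comp hs).norm.pow 2).const_mul m)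

theorem formConverges_iff [CompleteSpace G] (M : FormModel j q m i p) {s : ℕ → D} {u : H} :
    FormConverges j q s u ↔ ∃ x, p x = u ∧ Tendsto (fun n => i (s n)) atTop (𝓝 x) := by
  constructor
  · rintro ⟨hj, hq⟩
    have hjc := cauchySeq_iff_tendsto_dist_atTop_0.1 hj.cauchySeq
    have hsq : Tendsto (fun a : ℕ × ℕ => dist (i (s a.1)) (i (s a.2)) ^ 2) atTop (𝓝 0) := by
      have hsum := hq.add ((hjc.pow 2).const_mul m)
      simp_rw [dist_eq_norm, ← map_sub, ← M.norm_sq] at hsum ⊢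
      simpa using hsum
    have hic : CauchySeq fun n => i (s n) :=
      cauchySeq_iff_tendsto_dist_atTop_0.2 (by simpa using hsq.sqrt)
    obtain ⟨x, hx⟩ := cauchySeq_tendsto_of_complete hic
    refine ⟨x, tendsto_nhds_unique ((p.continuous.tendsto x).comp hx) ?_, hx⟩
    simpa only [Function.comp_def, M.map_eq] using hj
  · rintro ⟨x, rfl, hx⟩
    refine ⟨by simpa only [Function.comp_def, M.map_eq] using (p.continuous.tendsto x).comp hx, ?_⟩
    have hdiff : Tendsto (fun a : ℕ × ℕ => i (s a.1 - s a.2)) atTop (𝓝 0) := by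
      rw [tendsto_zero_iff_norm_tendsto_zero]
      simpa only [map_sub, dist_eq_norm] using
        cauchySeq_iff_tendsto_dist_atTop_0.1 hx.cauchySeq
    simpa using M.tendsto_form hdiff

theorem closable [CompleteSpace G] (M : FormModel j q m i p) : FormClosable j q := by
  intro s hs
  obtain ⟨x, hx, hlim⟩ := M.formConverges_iff.1 hs
  have hx0 : x = 0 := M.injective (hx.trans (map_zero p).symm)
  simpa [hx0] using M.tendsto_form hlim

theorem isFormClosure [CompleteSpace G] (M : FormModel j q m i p) :
    IsFormClosure j q (LinearMap.range (p : G →ₗ[ℂ] H)) (rangeForm p M.injective m) where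
  mem_domain_iff u := by
    constructor
    · rintro ⟨x, hx⟩
      obtain ⟨y, hy, hlim⟩ := mem_closure_iff_seq_limit.1 (M.denseRange x)
      choose s hs using hy
      exact ⟨s, M.formConverges_iff.2 ⟨x, hx, by simpa only [hs] using hlim⟩⟩
    · rintro ⟨s, hs⟩
      obtain ⟨x, hx, -⟩ := M.formConverges_iff.1 hs
      exact ⟨x, hx⟩
  tendsto_diag := by
    rintro ⟨u, hu⟩ s hs
    obtain ⟨x, rfl, hlim⟩ := M.formConverges_iff.1 hs
    rw [rangeForm_self]
    exact (Complex.continuous_ofReal.tendsto _).comp (M.tendsto_form hlim)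

theorem form_ge_of_mem_topologicalClosure (M : FormModel j q m i p) {E : ℝ} {N : Submodule ℂ D}
    (hN : ∀ u ∈ N, -E * ‖j u‖ ^ 2 ≤ q u) {x : G} (hx : x ∈ (N.map i).topologicalClosure) :
    (m - E) * ‖p x‖ ^ 2 ≤ ‖x‖ ^ 2 := by
  have hclosed : IsClosed {x : G | (m - E) * ‖p x‖ ^ 2 ≤ ‖x‖ ^ 2} :=
    isClosed_le (by fun_prop) (by fun_prop)
  refine closure_minimal ?_ hclosed hx
  rintro _ ⟨u, hu, rfl⟩
  have h := hN u hu
  rw [mem_ofPred_eq, M.map_eq, M.norm_sq]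
  linarith

variable [CompleteSpace G] [CompleteSpace H]

-- On the closure of `N` the form is at least `-E`, which caps `⟪p p† f, f⟫ = ‖p† f‖²` whenever
-- `p† f` lies in that closure, and these `f` have codimension at most that of `N`.
theorem upperIndexLE (M : FormModel j q m i p) {E : ℝ} (hE : E < m) (N : Submodule ℂ D)
    [FiniteDimensional ℂ (D ⧸ N)] (hN : ∀ u ∈ N, -E * ‖j u‖ ^ 2 ≤ q u) :
    UpperIndexLE (p.comp (adjoint p)) (m - E)⁻¹ (finrank ℂ (D ⧸ N)) := by
  intro W hW hexc
  obtain ⟨hfin, hle⟩ := finrank_quotient_topologicalClosure_map_le M.denseRange N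
  by_contra! hlt
  obtain ⟨⟨f, hfW⟩, hker, hf0⟩ := Submodule.exists_mem_ne_zero_of_ne_bot
    (((N.map i).topologicalClosure.mkQ ∘ₗ (adjoint p : H →ₗ[ℂ] G) ∘ₗ W.subtype
      ).ker_ne_bot_of_finrank_lt (hle.trans_lt hlt))
  have hmem : adjoint p f ∈ (N.map i).topologicalClosure :=
    (Submodule.Quotient.mk_eq_zero _).1 hker
  have hge := M.form_ge_of_mem_topologicalClosure hN hmem
  have hexcf := hexc f hfW fun h => hf0 (Subtype.ext h)
  have hinner : (inner ℂ (p (adjoint p f)) f).re = ‖adjoint p f‖ ^ 2 := by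
    rw [← adjoint_inner_right]
    exact inner_self_eq_norm_sq (𝕜 := ℂ) _
  have hcs : ‖adjoint p f‖ ^ 2 ≤ ‖p (adjoint p f)‖ * ‖f‖ :=
    hinner ▸ (Complex.re_le_norm _).trans (norm_inner_le_norm _ _)
  rw [comp_apply, hinner, inv_mul_lt_iff₀ (sub_pos.2 hE)] at hexcf
  nlinarith [sq_nonneg (‖f‖ - (m - E) * ‖p (adjoint p f)‖)]

end FormModel

end FormModel

section Trace

open Module

theorem tsum_mul_rpow_eq_lintegral {X : Type*} (d : X → ℝ≥0∞) {f : X → ℝ} (hf : ∀ x, 0 ≤ f x)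
    {γ : ℝ} (hγ : 0 < γ) :
    ∑' x, d x * ENNReal.ofReal (f x ^ γ) = ENNReal.ofReal γ * ∫⁻ t in Ioi (0 : ℝ),
      (∑' x, {x | t < f x}.indicator d x) * ENNReal.ofReal (t ^ (γ - 1)) := by
  let _ : MeasurableSpace X := ⊤
  have hlayer := lintegral_rpow_eq_lintegral_meas_lt_mul (Measure.count.withDensity d)
    (Eventually.of_forall hf) measurable_from_top.aemeasurable hγ
  rw [lintegral_withDensity_eq_lintegral_mul _ measurable_from_top measurable_from_top,
    lintegral_count] at hlayer
  refine hlayer.trans (congrArg _ (lintegral_congr fun t => ?_))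
  rw [withDensity_apply _ .of_discrete, ← lintegral_indicator .of_discrete, lintegral_count]

theorem tsum_mul_rpow_le {X Y : Type*} {d : X → ℝ≥0∞} {e : Y → ℝ≥0∞} {f : X → ℝ} {g : Y → ℝ}
    (hf : ∀ x, 0 ≤ f x) (hg : ∀ y, 0 ≤ g y) {γ : ℝ} (hγ : 0 < γ)
    (h : ∀ t : ℝ, 0 < t →
      ∑' x, {x | t < f x}.indicator d x ≤ ∑' y, {y | t < g y}.indicator e y) :
    ∑' x, d x * ENNReal.ofReal (f x ^ γ) ≤ ∑' y, e y * ENNReal.ofReal (g y ^ γ) := by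
  rw [tsum_mul_rpow_eq_lintegral d hf hγ, tsum_mul_rpow_eq_lintegral e hg hγ]
  exact mul_le_mul_right (setLIntegral_mono' measurableSet_Ioi fun t ht =>
    mul_le_mul_left (h t ht) _) _

variable {H : Type*} [NormedAddCommGroup H] [InnerProductSpace ℂ H]
variable {R : H →L[ℂ] H} {m : ℝ}

theorem pmapEigenspace_invSubConst_eq_bot (hR : R.IsPositive) (hinj : Function.Injective R)
    {l : ℝ} (hl : l + m ≤ 0) : pmapEigenspace (invSubConst R m) (l : ℂ) = ⊥ := by
  refine (Submodule.eq_bot_iff _).2 fun u hu => ?_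
  have hRu : ((l + m : ℝ) : ℂ) • R u = u := by
    rw [← map_smul, Complex.ofReal_add, add_smul]
    exact (mem_invSubConst_graph hinj).1 hu
  have hnorm : (l + m) * (inner ℂ (R u) u).re = ‖u‖ ^ 2 := by
    rw [← Complex.re_ofReal_mul, ← Complex.conj_ofReal, ← inner_smul_left, hRu]
    exact inner_self_eq_norm_sq (𝕜 := ℂ) u
  have hnonneg : 0 ≤ (inner ℂ (R u) u).re := hR.re_inner_nonneg_left u
  have hsq : ‖u‖ ^ 2 ≤ 0 := hnorm ▸ mul_nonpos_of_nonpos_of_nonneg hl hnonneg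
  simpa using hsq.antisymm (sq_nonneg _)

theorem pmapEigenspace_invSubConst_ofReal (hinj : Function.Injective R) {l : ℝ}
    (hl : 0 < l + m) :
    pmapEigenspace (invSubConst R m) (l : ℂ) =
      End.eigenspace (R : H →ₗ[ℂ] H) (((l + m)⁻¹ : ℝ) : ℂ) := by
  rw [pmapEigenspace_invSubConst hinj (by exact_mod_cast hl.ne')]
  push_cast
  rfl

theorem UpperIndexLE.sum_finrank_pmapEigenspace_le {E : ℝ} {n : ℕ}
    (h : UpperIndexLE R (m - E)⁻¹ n) (hR : R.IsPositive) (hinj : Function.Injective R)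
    {F : Finset ℝ} (hF : ∀ l ∈ F, l < -E) :
    ∑ l ∈ F, finrank ℂ (pmapEigenspace (invSubConst R m) (l : ℂ)) ≤ n := by
  have hsupp : ∀ l ∈ F, finrank ℂ (pmapEigenspace (invSubConst R m) (l : ℂ)) ≠ 0 → 0 < l + m :=
    fun l _ => not_imp_comm.1 fun hlm => by
      rw [pmapEigenspace_invSubConst_eq_bot hR hinj (not_lt.1 hlm), finrank_bot]
  rw [← Finset.sum_filter_of_ne hsupp, ← Finset.sum_coe_sort]
  have hpos (l : {l ∈ F | 0 < l + m}) : (l : ℝ) < -E ∧ 0 < (l : ℝ) + m :=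
    (Finset.mem_filter.1 l.2).imp_left (hF l)
  rw [Finset.sum_congr rfl fun l _ => by rw [pmapEigenspace_invSubConst_ofReal hinj (hpos l).2]]
  refine h.sum_finrank_eigenspace_le hR.isSymmetric (fun k l hkl => ?_) fun l => ?_
  · exact Subtype.ext (by simpa using hkl)
  · exact inv_strictAnti₀ (hpos l).2 (by linarith [(hpos l).1])

theorem sum_finrank_pmapEigenspace_eq_zero (hR : R.IsPositive) (hinj : Function.Injective R)
    {E : ℝ} (hE : m ≤ E) {F : Finset ℝ} (hF : ∀ l ∈ F, l < -E) :
    ∑ l ∈ F, finrank ℂ (pmapEigenspace (invSubConst R m) (l : ℂ)) = 0 :=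
  Finset.sum_eq_zero fun l hl => by
    rw [pmapEigenspace_invSubConst_eq_bot hR hinj (by linarith [hF l hl]), finrank_bot]

theorem traceNegPow_eq_tsum_finrank {A : H →ₗ.[ℂ] H}
    (hA : ∀ l : ℝ, l < 0 → FiniteDimensional ℂ (pmapEigenspace A (l : ℂ))) (γ : ℝ) :
    traceNegPow A γ = ∑' l : Iio (0 : ℝ), (finrank ℂ (pmapEigenspace A ((l : ℝ) : ℂ)) : ℝ≥0∞) *
      ENNReal.ofReal (|(l : ℝ)| ^ γ) := by
  refine tsum_congr fun l => ?_
  have := hA l l.2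
  rw [← finrank_eq_rank, map_natCast, ENat.toENNReal_coe]

theorem finiteDimensional_pmapEigenspace_invSubConst (hR : R.IsPositive)
    (hinj : Function.Injective R)
    (hindex : ∀ E : ℝ, 0 < E → E < m → ∃ n, UpperIndexLE R (m - E)⁻¹ n) {l : ℝ} (hl : l < 0) :
    FiniteDimensional ℂ (pmapEigenspace (invSubConst R m) (l : ℂ)) := by
  rcases le_or_gt (l + m) 0 with hlm | hlm
  · rw [pmapEigenspace_invSubConst_eq_bot hR hinj hlm]
    infer_instance
  · obtain ⟨n, hn⟩ := hindex (-l / 2) (by linarith) (by linarith)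
    rw [pmapEigenspace_invSubConst_ofReal hinj hlm]
    exact hn.finiteDimensional (exceedsOn_eigenspace (inv_strictAnti₀ hlm (by linarith)))

theorem traceNegPow_invSubConst_le (hR : R.IsPositive) (hinj : Function.Injective R)
    {ι : Type*} {a : ι → ℝ} (ha : ∀ k, 0 ≤ a k) (hfin : ∀ E : ℝ, 0 < E → {k | E < a k}.Finite)
    {c : ℕ} (hindex : ∀ E : ℝ, 0 < E → E < m →
      UpperIndexLE R (m - E)⁻¹ (c * {k | E < a k}.ncard)) {γ : ℝ} (hγ : 0 < γ) :
    traceNegPow (invSubConst R m) γ ≤ c * ∑' k, ENNReal.ofReal (a k ^ γ) := by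
  have hsum (t : ℝ) (ht : 0 < t) (F : Finset ℝ) (hF : ∀ l ∈ F, l < -t) :
      ∑ l ∈ F, finrank ℂ (pmapEigenspace (invSubConst R m) (l : ℂ)) ≤ c * {k | t < a k}.ncard := by
    rcases lt_or_ge t m with htm | htm
    · exact (hindex t ht htm).sum_finrank_pmapEigenspace_le hR hinj hF
    · exact (sum_finrank_pmapEigenspace_eq_zero hR hinj htm hF).trans_le (Nat.zero_le _)
  rw [traceNegPow_eq_tsum_finrank fun l hl => finiteDimensional_pmapEigenspace_invSubConst hR hinj
    (fun E h₀ hm => ⟨_, hindex E h₀ hm⟩) hl, ← ENNReal.tsum_mul_left]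
  refine tsum_mul_rpow_le (fun _ => abs_nonneg _) ha hγ fun t ht => ?_
  have hcount : ∑' k, {k | t < a k}.indicator (fun _ => (c : ℝ≥0∞)) k =
      (c * {k | t < a k}.ncard : ℕ) := by
    rw [← tsum_subtype, ENNReal.tsum_const, ENat.card_coe_set_eq, ← (hfin t ht).cast_ncard_eq]
    push_cast
    exact mul_comm _ _
  rw [hcount, ENNReal.tsum_eq_iSup_sum]
  refine iSup_le fun F => ?_
  classical
  have hF := hsum t ht ((F.filter fun l : Iio (0 : ℝ) => t < |(l : ℝ)|).map (.subtype _)) ?_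
  · rw [Finset.sum_map, Finset.sum_filter] at hF
    simp only [indicator_apply, mem_ofPred_eq]
    exact_mod_cast hF
  · simp only [Finset.mem_map, Finset.mem_filter]
    rintro _ ⟨l, ⟨-, hl⟩, rfl⟩
    rw [abs_of_neg l.2] at hl
    exact lt_neg_of_lt_neg hl

end Trace

section FormIndex

open Module ContinuousLinearMap

variable {H : Type*} [NormedAddCommGroup H] [InnerProductSpace ℂ H]
variable {G : Type*} [NormedAddCommGroup G] [InnerProductSpace ℂ G]
variable {D : Type*} [AddCommGroup D] [Module ℂ D]
variable {j : D →ₗ[ℂ] H} {q : D → ℝ} {ι : Type*} {c : ℕ} {a : ι → ℝ}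

theorem UpperIndexLE.mono {T : H →L[ℂ] H} {b : ℝ} {n k : ℕ} (h : UpperIndexLE T b n)
    (hnk : n ≤ k) : UpperIndexLE T b k :=
  fun W hW hexc => (h W hW hexc).trans hnk

/-- The form `q` has at most as much spectrum below `-E` as `c` copies of the sequence `-a`, for
every `E > 0`: it is bounded below by `-E` on a subspace of codimension at most
`c * #{k | E < a k}`, and this number is finite. -/
def FormIndexLE (j : D →ₗ[ℂ] H) (q : D → ℝ) (c : ℕ) (a : ι → ℝ) : Prop :=
  ∀ E : ℝ, 0 < E → {k | E < a k}.Finite ∧ ∃ N : Submodule ℂ D, FiniteDimensional ℂ (D ⧸ N) ∧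
    finrank ℂ (D ⧸ N) ≤ c * {k | E < a k}.ncard ∧ ∀ u ∈ N, -E * ‖j u‖ ^ 2 ≤ q u

theorem formIndexLE_of_forall_ker {Z : Type*} [AddCommGroup Z] [Module ℂ Z]
    [FiniteDimensional ℂ Z] (φ : ι → D →ₗ[ℂ] Z) (hfin : ∀ E : ℝ, 0 < E → {k | E < a k}.Finite)
    (hφ : ∀ E : ℝ, 0 < E → ∀ u, (∀ k, E < a k → φ k u = 0) → -E * ‖j u‖ ^ 2 ≤ q u) :
    FormIndexLE j q (finrank ℂ Z) a := by
  intro E hE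
  refine ⟨hfin E hE, ?_⟩
  have := (hfin E hE).fintype
  let Φ : D →ₗ[ℂ] ({k | E < a k} → Z) := LinearMap.pi fun k => φ k
  refine ⟨LinearMap.ker Φ, Module.Finite.equiv Φ.quotKerEquivRange.symm, ?_,
    fun u hu => hφ E hE u fun k hk => congrFun hu ⟨k, hk⟩⟩
  calc finrank ℂ (D ⧸ LinearMap.ker Φ) = finrank ℂ (LinearMap.range Φ) :=
        Φ.quotKerEquivRange.finrank_eq
    _ ≤ finrank ℂ ({k | E < a k} → Z) := Submodule.finrank_le _
    _ = finrank ℂ Z * {k | E < a k}.ncard := by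
        rw [finrank_pi_fintype, Finset.sum_const, Finset.card_univ, smul_eq_mul, mul_comm,
          ← Nat.card_coe_set_eq, Nat.card_eq_fintype_card]

variable [CompleteSpace H] [CompleteSpace G] {m : ℝ} {i : D →ₗ[ℂ] G} {p : G →L[ℂ] H}

theorem FormIndexLE.upperIndexLE (h : FormIndexLE j q c a) (M : FormModel j q m i p) {E : ℝ}
    (hE : 0 < E) (hEm : E < m) :
    UpperIndexLE (p.comp (adjoint p)) (m - E)⁻¹ (c * {k | E < a k}.ncard) := by
  obtain ⟨-, N, hfin, hle, hN⟩ := h E hE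
  exact (M.upperIndexLE hEm N hN).mono hle

theorem FormIndexLE.discreteNegativeSpectrum (h : FormIndexLE j q c a) (M : FormModel j q m i p)
    (hj : DenseRange j) : DiscreteNegativeSpectrum (invSubConst (p.comp (adjoint p)) m) :=
  discreteNegativeSpectrum_invSubConst (isPositive_self_comp_adjoint p)
    (injective_comp_adjoint (M.denseRange_embedding hj))
    fun _ hE hEm => ⟨_, h.upperIndexLE M hE hEm⟩

theorem FormIndexLE.traceNegPow_le (h : FormIndexLE j q c a) (M : FormModel j q m i p)
    (hj : DenseRange j) (ha : ∀ k, 0 ≤ a k) {γ : ℝ} (hγ : 0 < γ) :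
    traceNegPow (invSubConst (p.comp (adjoint p)) m) γ ≤ c * ∑' k, ENNReal.ofReal (a k ^ γ) :=
  traceNegPow_invSubConst_le (isPositive_self_comp_adjoint p)
    (injective_comp_adjoint (M.denseRange_embedding hj)) ha (fun E hE => (h E hE).1)
    (fun _ hE hEm => h.upperIndexLE M hE hEm) hγ

theorem FormModel.exists_formOperator_traceNegPow_le (M : FormModel j q m i p)
    (hj : DenseRange j) {γ B : ℝ} (hγ : 0 < γ)
    (hindex : ∀ δ : ℝ, 0 < δ → ∃ a : ι → ℝ, (∀ k, 0 ≤ a k) ∧ FormIndexLE j q c a ∧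
      ∑' k, ENNReal.ofReal (a k ^ γ) ≤ ENNReal.ofReal (B + δ)) :
    ∃ (Q : Submodule ℂ H) (b : Q →ₗ⋆[ℂ] Q →ₗ[ℂ] ℂ) (A : H →ₗ.[ℂ] H),
      IsFormClosure j q Q b ∧ IsFormOperator Q b A ∧ IsSelfAdjoint A ∧
        DiscreteNegativeSpectrum A ∧ traceNegPow A γ ≤ c * ENNReal.ofReal B := by
  have hR := injective_comp_adjoint (M.denseRange_embedding hj)
  refine ⟨_, rangeForm p M.injective m, invSubConst (p.comp (adjoint p)) m, M.isFormClosure,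
    isFormOperator_rangeForm M.injective m hR,
    isSelfAdjoint_invSubConst (isPositive_self_comp_adjoint p).isSelfAdjoint hR, ?_, ?_⟩
  · obtain ⟨a, -, ha, -⟩ := hindex 1 one_pos
    exact ha.discreteNegativeSpectrum M hj
  · have hlim : Tendsto (fun δ : ℝ => c * ENNReal.ofReal (B + δ)) (𝓝[>] 0)
        (𝓝 (c * ENNReal.ofReal (B + 0))) :=
      ENNReal.Tendsto.const_mul (ENNReal.tendsto_ofReal
        (continuous_const.add continuous_id).continuousWithinAt) (Or.inr (ENNReal.natCast_ne_top c))
    rw [add_zero] at hlim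
    refine ge_of_tendsto hlim (eventually_mem_nhdsWithin.mono fun δ hδ => ?_)
    obtain ⟨a, ha0, ha, hsum⟩ := hindex δ hδ
    exact (ha.traceNegPow_le M hj ha0 hγ).trans (mul_le_mul_right hsum _)

end FormIndex

section Gram

open ContinuousLinearMap

variable {H : Type*} [NormedAddCommGroup H] [InnerProductSpace ℂ H] [CompleteSpace H]
variable {G : Type*} [NormedAddCommGroup G] [InnerProductSpace ℂ G] [CompleteSpace G]

theorem exists_equiv_norm_sq_eq {T : G →L[ℂ] G} (hT : IsSelfAdjoint T) {c : ℝ} (hc : 0 < c)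
    (hcoercive : ∀ x, c * ‖x‖ ^ 2 ≤ (inner ℂ (T x) x).re) :
    ∃ S : G ≃L[ℂ] G, ∀ x, ‖S x‖ ^ 2 = (inner ℂ (T x) x).re := by
  have hpos : 0 ≤ T := (nonneg_iff_isPositive T).2 (isPositive_def'.2
    ⟨hT, fun x => le_trans (by positivity) (hcoercive x)⟩)
  have hunit : IsUnit T := isUnit_of_forall_le_norm_inner_map T (c := ⟨c, hc.le⟩) hc fun x =>
    (mul_comm _ _).trans_le ((hcoercive x).trans (Complex.re_le_norm _))
  obtain ⟨S, hS⟩ := (CFC.isUnit_sqrt_iff T hpos).2 hunit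
  refine ⟨ContinuousLinearEquiv.unitsEquiv ℂ G S, fun x => ?_⟩
  change ‖S.val x‖ ^ 2 = _
  have hsa : IsSelfAdjoint (CFC.sqrt T) := (CFC.sqrt_nonneg T).isSelfAdjoint
  have hsq : CFC.sqrt T (CFC.sqrt T x) = T x :=
    congrArg (fun B : G →L[ℂ] G => B x) (CFC.sqrt_mul_sqrt_self T hpos)
  have hsym : inner ℂ (CFC.sqrt T (CFC.sqrt T x)) x = inner ℂ (CFC.sqrt T x) (CFC.sqrt T x) :=
    hsa.isSymmetric _ _
  rw [hS, ← hsq, hsym]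
  exact (inner_self_eq_norm_sq (𝕜 := ℂ) _).symm

/-- The operator that represents the form `‖e x‖² - ‖r x‖² + m ‖p x‖²`. -/
def gramOp (p e r : G →L[ℂ] H) (m : ℝ) : G →L[ℂ] G :=
  (adjoint e).comp e - (adjoint r).comp r + (m : ℂ) • (adjoint p).comp p

theorem isSelfAdjoint_gramOp (p e r : G →L[ℂ] H) (m : ℝ) : IsSelfAdjoint (gramOp p e r m) := by
  have hsa (f : G →L[ℂ] H) : IsSelfAdjoint ((adjoint f).comp f) :=
    (isPositive_adjoint_comp_self f).isSelfAdjoint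
  exact ((hsa e).sub (hsa r)).add (IsSelfAdjoint.smul (Complex.conj_ofReal m) (hsa p))

theorem re_inner_gramOp (p e r : G →L[ℂ] H) (m : ℝ) (x : G) :
    (inner ℂ (gramOp p e r m x) x).re = ‖e x‖ ^ 2 - ‖r x‖ ^ 2 + m * ‖p x‖ ^ 2 := by
  have hself (f : G →L[ℂ] H) : inner ℂ (adjoint f (f x)) x = (‖f x‖ ^ 2 : ℝ) := by
    rw [adjoint_inner_left, inner_self_eq_norm_sq_to_K]
    push_cast
    rfl
  change (inner ℂ (adjoint e (e x) - adjoint r (r x) + (m : ℂ) • adjoint p (p x)) x).re = _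
  rw [inner_add_left, inner_sub_left, inner_smul_left, hself, hself, hself, Complex.conj_ofReal]
  norm_cast

end Gram

section GraphSpace

variable {H : Type*} [NormedAddCommGroup H] [InnerProductSpace ℂ H]
variable {D : Type*} [AddCommGroup D] [Module ℂ D]

/-- The map `u ↦ (j u, L u, r u)` into the Hilbert space `H³`. -/
def tripleMap (j L r : D →ₗ[ℂ] H) : D →ₗ[ℂ] PiLp 2 (fun _ : Fin 3 => H) :=
  (WithLp.linearEquiv 2 ℂ (Fin 3 → H)).symm.toLinearMap ∘ₗ LinearMap.pi ![j, L, r]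

/-- The completion of `D` in the norm `(‖j u‖² + ‖L u‖² + ‖r u‖²)^{1/2}`, realized in `H³`. -/
abbrev graphSpace (j L r : D →ₗ[ℂ] H) : Submodule ℂ (PiLp 2 (fun _ : Fin 3 => H)) :=
  (LinearMap.range (tripleMap j L r)).topologicalClosure

/-- The embedding of `D` into its completion `graphSpace j L r`. -/
def toGraphSpace (j L r : D →ₗ[ℂ] H) : D →ₗ[ℂ] graphSpace j L r :=
  (tripleMap j L r).codRestrict _ fun u => Submodule.le_topologicalClosure _ ⟨u, rfl⟩

/-- The continuous extensions of `j`, `L` and `r` to `graphSpace j L r`, for `k = 0, 1, 2`. -/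
def graphProj (j L r : D →ₗ[ℂ] H) (k : Fin 3) : graphSpace j L r →L[ℂ] H :=
  (PiLp.proj 2 (fun _ : Fin 3 => H) k).comp (graphSpace j L r).subtypeL

variable {j L r : D →ₗ[ℂ] H}

theorem norm_sq_graphSpace (x : graphSpace j L r) :
    ‖x‖ ^ 2 = ‖graphProj j L r 0 x‖ ^ 2 + ‖graphProj j L r 1 x‖ ^ 2 +
      ‖graphProj j L r 2 x‖ ^ 2 :=
  (PiLp.norm_sq_eq_of_L2 (fun _ : Fin 3 => H) x).trans (Fin.sum_univ_three _)

theorem denseRange_toGraphSpace : DenseRange (toGraphSpace j L r) := by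
  rw [DenseRange, Subtype.dense_iff]
  refine closure_mono ?_
  rintro _ ⟨u, rfl⟩
  exact ⟨toGraphSpace j L r u, ⟨u, rfl⟩, rfl⟩

theorem norm_graphProj_two_sq_le {a b : ℝ}
    (hbound : ∀ u, ‖r u‖ ^ 2 ≤ a * ‖L u‖ ^ 2 + b * ‖j u‖ ^ 2) (x : graphSpace j L r) :
    ‖graphProj j L r 2 x‖ ^ 2 ≤
      a * ‖graphProj j L r 1 x‖ ^ 2 + b * ‖graphProj j L r 0 x‖ ^ 2 :=
  denseRange_toGraphSpace.induction_on x (isClosed_le (by fun_prop) (by fun_prop)) hbound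

theorem injective_graphProj_zero {a b : ℝ}
    (hbound : ∀ u, ‖r u‖ ^ 2 ≤ a * ‖L u‖ ^ 2 + b * ‖j u‖ ^ 2)
    (hclosable : ∀ (s : ℕ → D) (h : H), Tendsto (fun n => j (s n)) atTop (𝓝 0) →
      Tendsto (fun n => L (s n)) atTop (𝓝 h) → h = 0) :
    Function.Injective (graphProj j L r 0) := by
  refine (injective_iff_map_eq_zero _).2 fun x hj => ?_
  obtain ⟨y, hy, hlim⟩ := mem_closure_iff_seq_limit.1 (denseRange_toGraphSpace x)
  choose s hs using hy
  have hproj (k : Fin 3) : Tendsto (fun n => graphProj j L r k (toGraphSpace j L r (s n))) atTop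
      (𝓝 (graphProj j L r k x)) :=
    ((graphProj j L r k).continuous.tendsto x).comp (by simpa only [hs] using hlim)
  have hL : graphProj j L r 1 x = 0 := hclosable s _ (hj ▸ hproj 0) (hproj 1)
  have hr := norm_graphProj_two_sq_le hbound x
  have hx := norm_sq_graphSpace x
  rw [hL, hj, norm_zero] at hr hx
  have hx0 : ‖x‖ ^ 2 = 0 := le_antisymm (by linarith) (sq_nonneg _)
  exact norm_eq_zero.1 (sq_eq_zero_iff.1 hx0)

-- The graph inner product is replaced by the equivalent one of the form, by means of the square
-- root of `gramOp`.
theorem exists_formModel [CompleteSpace H] {q : D → ℝ} {C : ℝ} (hC : 0 ≤ C)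
    (hq : ∀ u, q u = ‖L u‖ ^ 2 - ‖r u‖ ^ 2)
    (hbound : ∀ u, ‖r u‖ ^ 2 ≤ 1 / 2 * ‖L u‖ ^ 2 + C * ‖j u‖ ^ 2)
    (hclosable : ∀ (s : ℕ → D) (h : H), Tendsto (fun n => j (s n)) atTop (𝓝 0) →
      Tendsto (fun n => L (s n)) atTop (𝓝 h) → h = 0) :
    ∃ (i : D →ₗ[ℂ] graphSpace j L r) (p : graphSpace j L r →L[ℂ] H),
      FormModel j q (C + 1) i p := by
  let Γ := gramOp (graphProj j L r 0) (graphProj j L r 1) (graphProj j L r 2) (C + 1)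
  have hcoercive (x : graphSpace j L r) :
      (C + 3)⁻¹ * ‖x‖ ^ 2 ≤ (inner ℂ (Γ x) x).re := by
    rw [re_inner_gramOp, norm_sq_graphSpace, inv_mul_le_iff₀ (by positivity)]
    have hr := norm_graphProj_two_sq_le hbound x
    nlinarith [sq_nonneg ‖graphProj j L r 0 x‖, sq_nonneg ‖graphProj j L r 1 x‖,
      mul_nonneg hC (sq_nonneg ‖graphProj j L r 1 x‖)]
  obtain ⟨S, hS⟩ := exists_equiv_norm_sq_eq (isSelfAdjoint_gramOp _ _ _ (C + 1))
    (by positivity : 0 < (C + 3)⁻¹) hcoercive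
  refine ⟨S.toLinearMap ∘ₗ toGraphSpace j L r,
    (graphProj j L r 0).comp S.symm.toContinuousLinearMap, ?_, ?_, fun u => ?_, fun u => ?_⟩
  · exact S.surjective.denseRange.comp denseRange_toGraphSpace S.continuous
  · exact (injective_graphProj_zero hbound hclosable).comp S.symm.injective
  · exact congrArg (graphProj j L r 0) (S.symm_apply_apply _)
  · exact (hS _).trans ((re_inner_gramOp _ _ _ _ _).trans (congrArg (· + _) (hq u).symm))

end GraphSpace

section TestFunctionCalculus

theorem testFunction_eq_zero (u : 𝓓(halfLine, ℂ)) {x : ℝ} (hx : x ≤ 0) : u x = 0 :=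
  image_eq_zero_of_notMem_tsupport fun h => absurd (u.tsupport_subset h) (not_lt.2 hx)

theorem contDiff_rpow_smul_testFunction (s : ℝ) (u : 𝓓(halfLine, ℂ)) :
    ContDiff ℝ (⊤ : ℕ∞) fun x : ℝ => (x ^ s : ℝ) • u x := by
  rw [contDiff_iff_contDiffAt]
  intro x
  rcases le_or_gt x 0 with hx | hx
  · have hu : (u : ℝ → ℂ) =ᶠ[𝓝 x] 0 := notMem_tsupport_iff_eventuallyEq.1
      fun h => absurd (u.tsupport_subset h) (not_lt.2 hx)
    refine (contDiffAt_const (c := (0 : ℂ))).congr_of_eventuallyEq ?_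
    filter_upwards [hu] with y hy
    rw [hy, Pi.zero_apply, smul_zero]
  · exact (Real.contDiffAt_rpow_const_of_ne hx.ne').smul u.contDiff.contDiffAt

/-- Multiplication by `x ^ s` on `C₀^∞(0, ∞)`. -/
def mulRpow (s : ℝ) : 𝓓(halfLine, ℂ) →ₗ[ℂ] 𝓓(halfLine, ℂ) where
  toFun u := ⟨fun x => (x ^ s : ℝ) • u x, contDiff_rpow_smul_testFunction s u,
    HasCompactSupport.smul_left (f := fun x : ℝ => x ^ s) u.hasCompactSupport,
    (tsupport_smul_subset_right (fun x : ℝ => x ^ s) u).trans u.tsupport_subset⟩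
  map_add' u v := by ext x; exact smul_add _ _ _
  map_smul' c u := by ext x; exact smul_comm (x ^ s : ℝ) c (u x)

theorem mulRpow_apply (s : ℝ) (u : 𝓓(halfLine, ℂ)) (x : ℝ) :
    mulRpow s u x = (x ^ s : ℝ) • u x := rfl

theorem rpow_smul_mulRpow_neg (s : ℝ) (u : 𝓓(halfLine, ℂ)) {x : ℝ} (hx : 0 < x) :
    (x ^ s : ℝ) • mulRpow (-s) u x = u x := by
  rw [mulRpow_apply, smul_smul, ← Real.rpow_add hx, add_neg_cancel, Real.rpow_zero, one_smul]

theorem coe_mulRpow_neg (s : ℝ) (u : 𝓓(halfLine, ℂ)) :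
    (mulRpow (-s) u : ℝ → ℂ) = fun x : ℝ => (1 / x ^ s) • u x := by
  funext x
  rw [mulRpow_apply]
  rcases le_or_gt x 0 with hx | hx
  · rw [testFunction_eq_zero u hx, smul_zero, smul_zero]
  · rw [Real.rpow_neg hx.le, one_div]

/-- Differentiation on `C₀^∞(0, ∞)`. -/
def testDeriv : 𝓓(halfLine, ℂ) →ₗ[ℂ] 𝓓(halfLine, ℂ) where
  toFun u := ⟨deriv u, (contDiff_infty_iff_deriv.1 u.contDiff).2, u.hasCompactSupport.deriv,
    (closure_mono (support_deriv_subset (f := u))).trans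
      ((isClosed_tsupport _).closure_eq.subset.trans u.tsupport_subset)⟩
  map_add' u v := by
    ext x
    exact deriv_add (u.contDiff.differentiable (by simp) x) (v.contDiff.differentiable (by simp) x)
  map_smul' c u := by
    ext x
    exact deriv_const_smul c (u.contDiff.differentiable (by simp) x)

theorem hasDerivAt_testDeriv (u : 𝓓(halfLine, ℂ)) (x : ℝ) : HasDerivAt u (testDeriv u x) x :=
  (u.contDiff.differentiable (by simp) x).hasDerivAt

/-- The quotient `x^{-β} u` of a test function by the ground state `x^β`. -/
def quotFn (β : ℝ) : 𝓓(halfLine, ℂ) →ₗ[ℂ] 𝓓(halfLine, ℂ) := mulRpow (-β)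

/-- The quasi-derivative `x^{-α} (x^{-β} u)'`. -/
def quotDeriv (α β : ℝ) : 𝓓(halfLine, ℂ) →ₗ[ℂ] 𝓓(halfLine, ℂ) :=
  mulRpow (-α) ∘ₗ testDeriv ∘ₗ quotFn β

/-- The second-order operator `L u = x^{α+β} (x^{-α} (x^{-β} u)')'`, for which `H₀ = L* L`. -/
def diffOp (α β : ℝ) : 𝓓(halfLine, ℂ) →ₗ[ℂ] 𝓓(halfLine, ℂ) :=
  mulRpow (α + β) ∘ₗ testDeriv ∘ₗ quotDeriv α β

theorem weightedSecondDeriv_eq (α β : ℝ) (u : 𝓓(halfLine, ℂ)) (x : ℝ) :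
    weightedSecondDeriv α β u x = testDeriv (quotDeriv α β u) x := by
  rw [weightedSecondDeriv, ← coe_mulRpow_neg β u]
  exact congrArg (fun f => deriv f x) (coe_mulRpow_neg α (testDeriv (quotFn β u))).symm

theorem norm_diffOp_sq (α β : ℝ) (u : 𝓓(halfLine, ℂ)) {x : ℝ} (hx : 0 < x) :
    ‖diffOp α β u x‖ ^ 2 = ‖weightedSecondDeriv α β u x‖ ^ 2 * x ^ (2 * (α + β)) := by
  change ‖mulRpow (α + β) (testDeriv (quotDeriv α β u)) x‖ ^ 2 = _
  rw [weightedSecondDeriv_eq, mulRpow_apply, norm_smul, mul_pow, Real.norm_eq_abs, sq_abs, mul_comm,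
    mul_comm 2, Real.rpow_mul hx.le, Real.rpow_two]

theorem eq_rpow_smul_quotFn (β : ℝ) (u : 𝓓(halfLine, ℂ)) {x : ℝ} (hx : 0 < x) :
    u x = (x ^ β : ℝ) • quotFn β u x :=
  (rpow_smul_mulRpow_neg β u hx).symm

theorem testDeriv_quotFn (α β : ℝ) (u : 𝓓(halfLine, ℂ)) {x : ℝ} (hx : 0 < x) :
    testDeriv (quotFn β u) x = (x ^ α : ℝ) • quotDeriv α β u x :=
  (rpow_smul_mulRpow_neg α (testDeriv (quotFn β u)) hx).symm

theorem testDeriv_quotDeriv (α β : ℝ) (u : 𝓓(halfLine, ℂ)) {x : ℝ} (hx : 0 < x) :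
    testDeriv (quotDeriv α β u) x = (x ^ (-(α + β)) : ℝ) • diffOp α β u x := by
  rw [← rpow_smul_mulRpow_neg (-(α + β)) (testDeriv (quotDeriv α β u)) hx, neg_neg]
  rfl

end TestFunctionCalculus

section Embedding

theorem setIntegral_Ioi_eq_integral {f : ℝ → ℂ} (hf : ∀ x ≤ 0, f x = 0) :
    ∫ x in Ioi (0 : ℝ), f x = ∫ x, f x :=
  setIntegral_eq_integral_of_forall_compl_eq_zero fun x hx => hf x (not_lt.1 hx)

theorem coeFn_testToL2 (u : 𝓓(halfLine, ℂ)) :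
    (testToL2 u : ℝ → ℂ) =ᵐ[volume.restrict (Ioi (0 : ℝ))] u :=
  (testFunction_memLp u).coeFn_toLp

theorem inner_testToL2_left (u : 𝓓(halfLine, ℂ)) (h : L2HalfLine) :
    inner ℂ (testToL2 u) h = ∫ x in Ioi (0 : ℝ), inner ℂ (u x) (h x) := by
  rw [L2.inner_def]
  refine integral_congr_ae ?_
  filter_upwards [coeFn_testToL2 u] with x hx
  rw [hx]

theorem inner_testToL2 (u v : 𝓓(halfLine, ℂ)) :
    inner ℂ (testToL2 u) (testToL2 v) = ∫ x, star (u x) * v x := by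
  rw [inner_testToL2_left, ← setIntegral_Ioi_eq_integral fun x hx => by
    rw [testFunction_eq_zero v hx, mul_zero]]
  refine integral_congr_ae ?_
  filter_upwards [coeFn_testToL2 v] with x hx
  rw [hx, RCLike.inner_apply, mul_comm]
  rfl

theorem norm_toLp_sq {Ω : Type*} [MeasurableSpace Ω] {m : Measure Ω} {f : Ω → ℂ}
    (hf : MemLp f 2 m) : ‖hf.toLp f‖ ^ 2 = ∫ x, ‖f x‖ ^ 2 ∂m := by
  have hinner : inner ℂ (hf.toLp f) (hf.toLp f) = ((∫ x, ‖f x‖ ^ 2 ∂m : ℝ) : ℂ) := by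
    rw [L2.inner_def, ← integral_complex_ofReal]
    refine integral_congr_ae ?_
    filter_upwards [hf.coeFn_toLp] with x hx
    rw [hx, inner_self_eq_norm_sq_to_K, Complex.ofReal_pow]
    rfl
  rw [norm_sq_eq_re_inner (𝕜 := ℂ), hinner]
  exact Complex.ofReal_re _

theorem norm_testToL2_sq (u : 𝓓(halfLine, ℂ)) :
    ‖testToL2 u‖ ^ 2 = ∫ x in Ioi (0 : ℝ), ‖u x‖ ^ 2 :=
  norm_toLp_sq (testFunction_memLp u)

theorem inner_testToL2_mulRpow (s : ℝ) (u v : 𝓓(halfLine, ℂ)) :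
    inner ℂ (testToL2 u) (testToL2 (mulRpow s v)) =
      inner ℂ (testToL2 (mulRpow s u)) (testToL2 v) := by
  rw [inner_testToL2, inner_testToL2]
  refine integral_congr_ae (Eventually.of_forall fun x => ?_)
  simp only [mulRpow_apply, Complex.real_smul, star_mul, Complex.star_def, Complex.conj_ofReal]
  ring

theorem integrable_star_mul (u v : 𝓓(halfLine, ℂ)) : Integrable fun x => star (u x) * v x :=
  (u.continuous.star.mul v.continuous).integrable_of_hasCompactSupport v.hasCompactSupport.mul_left

theorem inner_testToL2_testDeriv (u v : 𝓓(halfLine, ℂ)) :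
    inner ℂ (testToL2 u) (testToL2 (testDeriv v)) =
      -inner ℂ (testToL2 (testDeriv u)) (testToL2 v) := by
  rw [inner_testToL2, inner_testToL2]
  exact integral_mul_deriv_eq_deriv_mul_of_integrable
    (fun x _ => (hasDerivAt_testDeriv u x).star) (fun x _ => hasDerivAt_testDeriv v x)
    (integrable_star_mul u (testDeriv v)) (integrable_star_mul (testDeriv u) v)
    (integrable_star_mul u v)

theorem exists_formalAdjoint_diffOp (α β : ℝ) (v : 𝓓(halfLine, ℂ)) :
    ∃ w : 𝓓(halfLine, ℂ), ∀ u, inner ℂ (testToL2 v) (testToL2 (diffOp α β u)) =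
      inner ℂ (testToL2 w) (testToL2 u) := by
  refine ⟨mulRpow (-β) (testDeriv (mulRpow (-α) (testDeriv (mulRpow (α + β) v)))), fun u => ?_⟩
  simp only [diffOp, quotDeriv, quotFn, LinearMap.comp_apply]
  rw [inner_testToL2_mulRpow, inner_testToL2_testDeriv, inner_testToL2_mulRpow,
    inner_testToL2_testDeriv, neg_neg, inner_testToL2_mulRpow]

/-- A smooth real function with compact support in `(0, ∞)`, as an element of `C₀^∞(0, ∞)`. -/
def realTestFunction {g : ℝ → ℝ} (hg : ContDiff ℝ (⊤ : ℕ∞) g) (hgc : HasCompactSupport g)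
    (hgs : tsupport g ⊆ Ioi 0) : 𝓓(halfLine, ℂ) :=
  ⟨fun x => (g x : ℂ), Complex.ofRealCLM.contDiff.comp hg,
    hgc.comp_left (g := fun t : ℝ => (t : ℂ)) Complex.ofReal_zero,
    (tsupport_comp_subset Complex.ofReal_zero g).trans hgs⟩

theorem eq_zero_of_inner_testToL2 (h : L2HalfLine)
    (hh : ∀ u : 𝓓(halfLine, ℂ), inner ℂ (testToL2 u) h = 0) : h = 0 := by
  have hloc : LocallyIntegrableOn (h : ℝ → ℂ) (Ioi 0) :=
    locallyIntegrableOn_of_locallyIntegrable_restrict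
      ((Lp.memLp h).locallyIntegrable (by norm_num))
  have hsmul : ∀ g : ℝ → ℝ, ContDiff ℝ (⊤ : ℕ∞) g → HasCompactSupport g → tsupport g ⊆ Ioi 0 →
      ∫ x, g x • h x = 0 := by
    intro g hg hgc hgs
    have hg0 : ∀ x ≤ 0, g x = 0 := fun x hx =>
      image_eq_zero_of_notMem_tsupport fun hmem => absurd (hgs hmem) (not_lt.2 hx)
    rw [← setIntegral_Ioi_eq_integral fun x hx => by rw [hg0 x hx, zero_smul],
      ← hh (realTestFunction hg hgc hgs), inner_testToL2_left]
    refine integral_congr_ae (Eventually.of_forall fun x => ?_)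
    change g x • h x = inner ℂ (g x : ℂ) (h x)
    rw [RCLike.inner_apply, Complex.conj_ofReal, Complex.real_smul, mul_comm]
  rw [Lp.eq_zero_iff_ae_eq_zero]
  exact (ae_restrict_iff' measurableSet_Ioi).2
    (isOpen_Ioi.ae_eq_zero_of_integral_contDiff_smul_eq_zero hloc hsmul)

theorem denseRange_testToL2 : DenseRange testToL2 := by
  have hclosure : (LinearMap.range testToL2).topologicalClosure = ⊤ := by
    rw [Submodule.topologicalClosure_eq_top_iff, Submodule.eq_bot_iff]
    exact fun h hh => eq_zero_of_inner_testToL2 h fun u => hh _ ⟨u, rfl⟩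
  exact Submodule.dense_iff_topologicalClosure_eq_top.2 hclosure

theorem eq_zero_of_tendsto_diffOp (α β : ℝ) {ι : Type*} {l : Filter ι} [l.NeBot]
    {s : ι → 𝓓(halfLine, ℂ)} {h : L2HalfLine} (hs : Tendsto (fun n => testToL2 (s n)) l (𝓝 0))
    (hLs : Tendsto (fun n => testToL2 (diffOp α β (s n))) l (𝓝 h)) : h = 0 := by
  refine eq_zero_of_inner_testToL2 h fun v => ?_
  obtain ⟨w, hw⟩ := exists_formalAdjoint_diffOp α β v
  have hv_lim := (tendsto_const_nhds (x := testToL2 v)).inner (𝕜 := ℂ) hLs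
  have hw_lim := (tendsto_const_nhds (x := testToL2 w)).inner (𝕜 := ℂ) hs
  rw [inner_zero_right] at hw_lim
  exact tendsto_nhds_unique hv_lim (hw_lim.congr fun n => (hw _).symm)

end Embedding

section RpowPrimitive

/-- The primitive `x^{α+1} / (α+1)` of `x^α` that vanishes at `0`. -/
def rpowPrim (α x : ℝ) : ℝ := x ^ (α + 1) / (α + 1)

theorem hasDerivAt_rpowPrim {α : ℝ} (hα : -1 < α) {x : ℝ} (hx : 0 < x) :
    HasDerivAt (rpowPrim α) (x ^ α) x := by
  have hα1 : α + 1 ≠ 0 := by linarith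
  refine ((Real.hasDerivAt_rpow_const (p := α + 1) (Or.inl hx.ne')).div_const
    (α + 1)).congr_deriv ?_
  rw [add_sub_cancel_right, mul_div_cancel_left₀ _ hα1]

theorem rpowPrim_sub_eq_integral {α : ℝ} (hα : -1 < α) (x z : ℝ) :
    rpowPrim α z - rpowPrim α x = ∫ t in x..z, t ^ α := by
  rw [integral_rpow (Or.inl hα), rpowPrim, rpowPrim, sub_div]

theorem rpowPrim_sub_le {α : ℝ} (hα : 0 ≤ α) {x z : ℝ} (hx : 0 ≤ x) (hxz : x ≤ z) :
    rpowPrim α z - rpowPrim α x ≤ z ^ α * (z - x) := by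
  have h := intervalIntegral.integral_mono_on (f := fun t => t ^ α) (g := fun _ => z ^ α) hxz
    (intervalIntegral.intervalIntegrable_rpow' (by linarith)) intervalIntegrable_const
    (fun t ht => Real.rpow_le_rpow (hx.trans ht.1) ht.2 hα)
  rwa [← rpowPrim_sub_eq_integral (by linarith), intervalIntegral.integral_const, smul_eq_mul,
    mul_comm] at h

theorem le_rpowPrim_sub {α : ℝ} (hα : 0 ≤ α) {x z : ℝ} (hx : 0 ≤ x) (hxz : x ≤ z) :
    x ^ α * (z - x) ≤ rpowPrim α z - rpowPrim α x := by
  have h := intervalIntegral.integral_mono_on (f := fun _ => x ^ α) (g := fun t => t ^ α) hxz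
    intervalIntegrable_const (intervalIntegral.intervalIntegrable_rpow' (by linarith))
    (fun t ht => Real.rpow_le_rpow hx ht.1 hα)
  rwa [← rpowPrim_sub_eq_integral (by linarith), intervalIntegral.integral_const, smul_eq_mul,
    mul_comm] at h

theorem monotoneOn_rpowPrim {α : ℝ} (hα : -1 < α) : MonotoneOn (rpowPrim α) (Ici 0) := by
  intro x hx z _ hxz
  exact div_le_div_of_nonneg_right (Real.rpow_le_rpow hx hxz (by linarith)) (by linarith)

end RpowPrimitive

section CauchySchwarz

theorem sq_integral_mul_le {Ω : Type*} [MeasurableSpace Ω] {μ : Measure Ω} {k h : Ω → ℝ}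
    (hk : MemLp k 2 μ) (hh : MemLp h 2 μ) :
    (∫ z, k z * h z ∂μ) ^ 2 ≤ (∫ z, k z ^ 2 ∂μ) * ∫ z, h z ^ 2 ∂μ := by
  have inner_toLp : ∀ {f g : Ω → ℝ} (hf : MemLp f 2 μ) (hg : MemLp g 2 μ),
      inner ℝ (hf.toLp f) (hg.toLp g) = ∫ z, f z * g z ∂μ := by
    intro f g hf hg
    rw [L2.inner_def]
    refine integral_congr_ae ?_
    filter_upwards [hf.coeFn_toLp, hg.coeFn_toLp] with z hfz hgz
    rw [hfz, hgz, RCLike.inner_apply, mul_comm]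
    rfl
  have hcs := real_inner_mul_inner_self_le (hk.toLp k) (hh.toLp h)
  simpa only [inner_toLp, ← sq] using hcs

theorem rpow_sq_eq_rpow_two_mul (s : ℝ) {t : ℝ} (ht : 0 ≤ t) : (t ^ s) ^ 2 = t ^ (2 * s) := by
  rw [mul_comm, Real.rpow_mul ht, Real.rpow_two]

theorem setIntegral_sub_rpow_sq {s : ℝ} (hs : -1 < 2 * s) {x b : ℝ} (hxb : x ≤ b) :
    ∫ z in Ioc x b, ((z - x) ^ s) ^ 2 = (b - x) ^ (2 * s + 1) / (2 * s + 1) := by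
  rw [setIntegral_congr_fun measurableSet_Ioc fun z hz =>
    rpow_sq_eq_rpow_two_mul s (sub_nonneg.2 hz.1.le), ← intervalIntegral.integral_of_le hxb,
    intervalIntegral.integral_comp_sub_right (fun z => z ^ (2 * s)), sub_self,
    integral_rpow (Or.inl hs), Real.zero_rpow (by linarith), sub_zero]

theorem memLp_two_sub_rpow {s : ℝ} (hs : -1 < 2 * s) {x b : ℝ} (hxb : x ≤ b) :
    MemLp (fun z => (z - x) ^ s) 2 (volume.restrict (Ioc x b)) := by
  have hmeas : Measurable fun z : ℝ => (z - x) ^ s := by fun_prop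
  have hint : IntervalIntegrable (fun z => (z - x) ^ (2 * s)) volume x b := by
    simpa using (intervalIntegral.intervalIntegrable_rpow' (a := 0) (b := b - x)
      hs).comp_sub_right x
  refine (memLp_two_iff_integrable_sq hmeas.aestronglyMeasurable).2 ?_
  exact ((intervalIntegrable_iff_integrableOn_Ioc_of_le hxb).1 hint).congr_fun
    (fun z hz => (rpow_sq_eq_rpow_two_mul s (sub_nonneg.2 hz.1.le)).symm) measurableSet_Ioc

theorem memLp_two_norm_restrict_Ioc (v : 𝓓(halfLine, ℂ)) (x b : ℝ) :
    MemLp (fun z => ‖v z‖) 2 (volume.restrict (Ioc x b)) :=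
  ((v.continuous.memLp_of_hasCompactSupport v.hasCompactSupport).restrict _).norm

end CauchySchwarz

section KernelPart

/-- The quotient `x^{-β} φ` of the function `φ = kernelPart α β u b` defined below; it is an affine
function of `rpowPrim α`. -/
def quotKernelPart (α β : ℝ) (u : 𝓓(halfLine, ℂ)) (b x : ℝ) : ℂ :=
  quotFn β u b - (rpowPrim α b - rpowPrim α x) • quotDeriv α β u b

/-- The function in the kernel of the differential expression with the Cauchy data of `u`
at `b`. -/
def kernelPart (α β : ℝ) (u : 𝓓(halfLine, ℂ)) (b x : ℝ) : ℂ :=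
  (x ^ β : ℝ) • quotKernelPart α β u b x

theorem norm_kernelPart (α β : ℝ) (u : 𝓓(halfLine, ℂ)) (b : ℝ) {x : ℝ} (hx : 0 ≤ x) :
    ‖kernelPart α β u b x‖ = x ^ β * ‖quotKernelPart α β u b x‖ := by
  rw [kernelPart, norm_smul, Real.norm_of_nonneg (by positivity)]

theorem quotFn_eq_quotKernelPart_add_integral {α : ℝ} (β : ℝ) (hα : -1 < α) (u : 𝓓(halfLine, ℂ))
    {x b : ℝ} (hx : 0 < x) (hxb : x ≤ b) :
    quotFn β u x = quotKernelPart α β u b x +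
      ∫ z in x..b, (rpowPrim α z - rpowPrim α x) • testDeriv (quotDeriv α β u) z := by
  have hpos : ∀ z ∈ uIcc x b, 0 < z := fun z hz => by
    rw [uIcc_of_le hxb] at hz
    exact hx.trans_le hz.1
  have hderiv : ∀ z ∈ uIcc x b, HasDerivAt
      (fun z => quotFn β u z - (rpowPrim α z - rpowPrim α x) • quotDeriv α β u z)
      (-((rpowPrim α z - rpowPrim α x) • testDeriv (quotDeriv α β u) z)) z := by
    intro z hz
    refine ((hasDerivAt_testDeriv (quotFn β u) z).sub
      (((hasDerivAt_rpowPrim hα (hpos z hz)).sub_const (rpowPrim α x)).smul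
        (hasDerivAt_testDeriv (quotDeriv α β u) z))).congr_deriv ?_
    rw [testDeriv_quotFn α β u (hpos z hz)]
    abel
  have hcont : ContinuousOn (fun z => rpowPrim α z - rpowPrim α x) (uIcc x b) := fun z hz =>
    ((hasDerivAt_rpowPrim hα (hpos z hz)).continuousAt.sub
      continuousAt_const).continuousWithinAt
  have hftc := intervalIntegral.integral_eq_sub_of_hasDerivAt hderiv
    ((hcont.smul (testDeriv (quotDeriv α β u)).continuous.continuousOn).neg.intervalIntegrable)
  rw [intervalIntegral.integral_neg, sub_self, zero_smul, sub_zero] at hftc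
  rw [neg_eq_iff_eq_neg.1 hftc, quotKernelPart]
  abel

theorem sub_kernelPart_eq_integral {α : ℝ} (β : ℝ) (hα : -1 < α) (u : 𝓓(halfLine, ℂ)) {x b : ℝ}
    (hx : 0 < x) (hxb : x ≤ b) :
    u x - kernelPart α β u b x = (x ^ β : ℝ) •
      ∫ z in x..b, (rpowPrim α z - rpowPrim α x) • testDeriv (quotDeriv α β u) z := by
  rw [eq_rpow_smul_quotFn β u hx, kernelPart, ← smul_sub,
    quotFn_eq_quotKernelPart_add_integral β hα u hx hxb, add_sub_cancel_left]

end KernelPart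

section Remainder

variable {α β μ : ℝ}

theorem rpow_mul_rpowPrim_sub_mul_rpow_le (hα : 0 ≤ α) (hμ : 0 ≤ μ) (hμβ : μ ≤ 2 * β) {x z : ℝ}
    (hx : 0 < x) (hxz : x < z) :
    x ^ (β + -μ / 2) * (rpowPrim α z - rpowPrim α x) * z ^ (-(α + β)) ≤ (z - x) ^ (1 - μ / 2) := by
  have hz : 0 < z := hx.trans hxz
  have hzx : 0 < z - x := sub_pos.2 hxz
  have hβμ : 0 ≤ β + -μ / 2 := by linarith
  calc x ^ (β + -μ / 2) * (rpowPrim α z - rpowPrim α x) * z ^ (-(α + β))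
      ≤ z ^ (β + -μ / 2) * (z ^ α * (z - x)) * z ^ (-(α + β)) := by
        have hprim : rpowPrim α x ≤ rpowPrim α z :=
          monotoneOn_rpowPrim (by linarith) hx.le hz.le hxz.le
        exact mul_le_mul_of_nonneg_right (mul_le_mul (Real.rpow_le_rpow hx.le hxz.le hβμ)
          (rpowPrim_sub_le hα hx.le hxz.le) (sub_nonneg.2 hprim) (by positivity)) (by positivity)
    _ = z ^ (-μ / 2) * (z - x) := by
        have hexp : z ^ (-μ / 2) = z ^ (β + -μ / 2) * z ^ α * z ^ (-(α + β)) := by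
          rw [← Real.rpow_add hz, ← Real.rpow_add hz]
          ring_nf
        rw [hexp]
        ring
    _ ≤ (z - x) ^ (-μ / 2) * (z - x) :=
        mul_le_mul_of_nonneg_right
          (Real.rpow_le_rpow_of_nonpos hzx (by linarith) (by linarith)) hzx.le
    _ = (z - x) ^ (1 - μ / 2) := by
        rw [← Real.rpow_add_one hzx.ne']
        ring_nf

theorem norm_sub_kernelPart_mul_rpow_le (hα : 0 ≤ α) (hμ : 0 ≤ μ) (hμ3 : μ < 3)
    (hμβ : μ ≤ 2 * β) (u : 𝓓(halfLine, ℂ)) {x b : ℝ} (hx : 0 < x) (hxb : x ≤ b) :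
    ‖u x - kernelPart α β u b x‖ * x ^ (-μ / 2) ≤
      ∫ z in Ioc x b, (z - x) ^ (1 - μ / 2) * ‖diffOp α β u z‖ := by
  have hint : IntervalIntegrable (fun z => (z - x) ^ (1 - μ / 2) * ‖diffOp α β u z‖) volume x b :=
    (intervalIntegrable_iff_integrableOn_Ioc_of_le hxb).2
      ((memLp_two_sub_rpow (by linarith) hxb).integrable_mul
        (memLp_two_norm_restrict_Ioc (diffOp α β u) x b))
  rw [sub_kernelPart_eq_integral β (by linarith) u hx hxb, norm_smul,
    Real.norm_of_nonneg (by positivity), mul_right_comm, ← Real.rpow_add hx,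
    ← Real.norm_of_nonneg (by positivity : 0 ≤ x ^ (β + -μ / 2)), ← norm_smul,
    ← intervalIntegral.integral_smul, ← intervalIntegral.integral_of_le hxb]
  refine intervalIntegral.norm_integral_le_of_norm_le hxb (Eventually.of_forall fun z hz => ?_) hint
  have hz : x < z := hz.1
  have hz0 : 0 < z := hx.trans hz
  have hprim : 0 ≤ rpowPrim α z - rpowPrim α x :=
    sub_nonneg.2 (monotoneOn_rpowPrim (by linarith) hx.le hz0.le hz.le)
  rw [testDeriv_quotDeriv α β u hz0, norm_smul, norm_smul, norm_smul,
    Real.norm_of_nonneg (by positivity), Real.norm_of_nonneg hprim,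
    Real.norm_of_nonneg (by positivity), ← mul_assoc, ← mul_assoc]
  exact mul_le_mul_of_nonneg_right (rpow_mul_rpowPrim_sub_mul_rpow_le hα hμ hμβ hx hz)
    (norm_nonneg _)

theorem norm_sub_kernelPart_sq_mul_rpow_le (hα : 0 ≤ α) (hμ : 0 ≤ μ) (hμ3 : μ < 3)
    (hμβ : μ ≤ 2 * β) (u : 𝓓(halfLine, ℂ)) {a b x : ℝ} (hx : 0 < x) (hax : a ≤ x) (hxb : x ≤ b) :
    ‖u x - kernelPart α β u b x‖ ^ 2 * x ^ (-μ) ≤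
      (b - a) ^ (3 - μ) / (3 - μ) * ∫ z in a..b, ‖diffOp α β u z‖ ^ 2 := by
  have h3μ : 0 < 3 - μ := by linarith
  calc ‖u x - kernelPart α β u b x‖ ^ 2 * x ^ (-μ)
      = (‖u x - kernelPart α β u b x‖ * x ^ (-μ / 2)) ^ 2 := by
        rw [mul_pow, rpow_sq_eq_rpow_two_mul _ hx.le, mul_div_cancel₀ _ two_ne_zero]
    _ ≤ (∫ z in Ioc x b, (z - x) ^ (1 - μ / 2) * ‖diffOp α β u z‖) ^ 2 :=
        pow_le_pow_left₀ (by positivity)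
          (norm_sub_kernelPart_mul_rpow_le hα hμ hμ3 hμβ u hx hxb) 2
    _ ≤ (∫ z in Ioc x b, ((z - x) ^ (1 - μ / 2)) ^ 2) * ∫ z in Ioc x b, ‖diffOp α β u z‖ ^ 2 :=
        sq_integral_mul_le (memLp_two_sub_rpow (by linarith) hxb)
          (memLp_two_norm_restrict_Ioc (diffOp α β u) x b)
    _ = (b - x) ^ (3 - μ) / (3 - μ) * ∫ z in x..b, ‖diffOp α β u z‖ ^ 2 := by
        rw [setIntegral_sub_rpow_sq (by linarith) hxb, intervalIntegral.integral_of_le hxb]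
        ring_nf
    _ ≤ (b - a) ^ (3 - μ) / (3 - μ) * ∫ z in a..b, ‖diffOp α β u z‖ ^ 2 := by
        have hmono : ∫ z in x..b, ‖diffOp α β u z‖ ^ 2 ≤ ∫ z in a..b, ‖diffOp α β u z‖ ^ 2 :=
          intervalIntegral.integral_mono_interval hax hxb le_rfl
            (Eventually.of_forall fun z => by positivity)
            (((diffOp α β u).continuous.norm.pow 2).intervalIntegrable a b)
        have hnonneg : 0 ≤ ∫ z in x..b, ‖diffOp α β u z‖ ^ 2 :=
          intervalIntegral.integral_nonneg hxb fun z _ => by positivity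
        exact mul_le_mul (div_le_div_of_nonneg_right
          (Real.rpow_le_rpow (by linarith) (by linarith) h3μ.le) h3μ.le) hmono hnonneg
          (div_nonneg (Real.rpow_nonneg (by linarith) _) h3μ.le)

end Remainder

section Sobolev

variable {α β μ : ℝ}

theorem norm_add_smul_le_of_two_points {E : Type*} [NormedAddCommGroup E] [NormedSpace ℝ E]
    (c d : E) {p q₁ q₂ g S : ℝ} (hg : 0 < g) (hgap : g ≤ q₂ - q₁) (h₁ : |p - q₁| ≤ S)
    (h₂ : |q₂ - p| ≤ S) : ‖c + p • d‖ ≤ S / g * (‖c + q₁ • d‖ + ‖c + q₂ • d‖) := by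
  have hinterp : (q₂ - q₁) • (c + p • d) = (q₂ - p) • (c + q₁ • d) + (p - q₁) • (c + q₂ • d) := by
    module
  rw [div_mul_eq_mul_div, le_div_iff₀ hg, mul_comm]
  calc g * ‖c + p • d‖ ≤ ‖(q₂ - q₁) • (c + p • d)‖ := by
        rw [norm_smul]
        exact mul_le_mul_of_nonneg_right (hgap.trans (le_abs_self _)) (norm_nonneg _)
    _ ≤ |q₂ - p| * ‖c + q₁ • d‖ + |p - q₁| * ‖c + q₂ • d‖ := by
        rw [hinterp]
        refine (norm_add_le _ _).trans_eq ?_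
        rw [norm_smul, norm_smul, Real.norm_eq_abs, Real.norm_eq_abs]
    _ ≤ S * (‖c + q₁ • d‖ + ‖c + q₂ • d‖) := by
        rw [mul_add]
        gcongr

theorem rpow_eq_two_rpow_mul_half_rpow (s : ℝ) {b : ℝ} (hb : 0 ≤ b) :
    b ^ s = 2 ^ s * (b / 2) ^ s := by
  rw [← Real.mul_rpow zero_le_two (by positivity), mul_div_cancel₀ b two_ne_zero]

theorem norm_quotKernelPart_le (hα : 0 ≤ α) (u : 𝓓(halfLine, ℂ)) {a b x y₁ y₂ : ℝ} (ha : 0 ≤ a)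
    (hax : a ≤ x) (hxb : x ≤ b) (hab : a < b) (hy₁ : b - (b - a) / 2 ≤ y₁)
    (hy : y₁ + (b - a) / 4 ≤ y₂) (hy₂ : y₂ ≤ b) :
    ‖quotKernelPart α β u b x‖ ≤
      4 * 2 ^ α * (‖quotKernelPart α β u b y₁‖ + ‖quotKernelPart α β u b y₂‖) := by
  have hb : 0 < b := ha.trans_lt hab
  have hba : 0 < b - a := sub_pos.2 hab
  have mono : ∀ {s t : ℝ}, 0 ≤ s → s ≤ t → rpowPrim α s ≤ rpowPrim α t := fun hs hst =>
    monotoneOn_rpowPrim (by linarith) hs (hs.trans hst) hst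
  have hgap : (b / 2) ^ α * ((b - a) / 4) ≤ rpowPrim α y₂ - rpowPrim α y₁ :=
    (mul_le_mul (Real.rpow_le_rpow (by positivity) (by linarith) hα) (by linarith)
      (by positivity) (Real.rpow_nonneg (by linarith) _)).trans
      (le_rpowPrim_sub hα (by linarith) (by linarith))
  have hspan : rpowPrim α b - rpowPrim α a ≤ b ^ α * (b - a) := rpowPrim_sub_le hα ha hab.le
  have hx_mem : rpowPrim α x ∈ Icc (rpowPrim α a) (rpowPrim α b) :=
    ⟨mono ha hax, mono (ha.trans hax) hxb⟩
  have hy₁_mem : rpowPrim α y₁ ∈ Icc (rpowPrim α a) (rpowPrim α b) :=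
    ⟨mono ha (by linarith), mono (by linarith) (by linarith)⟩
  have hy₂_mem : rpowPrim α y₂ ∈ Icc (rpowPrim α a) (rpowPrim α b) :=
    ⟨mono ha (by linarith), mono (by linarith) hy₂⟩
  have haffine : ∀ y, quotKernelPart α β u b y = (quotFn β u b - rpowPrim α b • quotDeriv α β u b) +
      rpowPrim α y • quotDeriv α β u b := fun y => by
    rw [quotKernelPart]
    module
  have hratio : b ^ α * (b - a) / ((b / 2) ^ α * ((b - a) / 4)) = 4 * 2 ^ α := by
    rw [rpow_eq_two_rpow_mul_half_rpow α hb.le]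
    field_simp
  rw [haffine, haffine, haffine, ← hratio]
  exact norm_add_smul_le_of_two_points _ _ (by positivity) hgap
    ((abs_sub_le_of_le_of_le hx_mem.1 hx_mem.2 hy₁_mem.1 hy₁_mem.2).trans hspan)
    ((abs_sub_le_of_le_of_le hy₂_mem.1 hy₂_mem.2 hx_mem.1 hx_mem.2).trans hspan)

theorem norm_quotKernelPart_le_norm_kernelPart (α : ℝ) (hβ : 0 ≤ β) (u : 𝓓(halfLine, ℂ))
    {b y : ℝ} (hb : 0 < b) (hy : b / 2 ≤ y) :
    ‖quotKernelPart α β u b y‖ ≤ (b / 2) ^ (-β) * ‖kernelPart α β u b y‖ := by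
  rw [norm_kernelPart α β u b (by linarith), ← mul_assoc]
  refine le_mul_of_one_le_left (norm_nonneg _) ?_
  rw [Real.rpow_neg (by positivity), inv_mul_eq_div, one_le_div (by positivity)]
  exact Real.rpow_le_rpow (by positivity) hy hβ

theorem norm_kernelPart_mul_rpow_le (hα : 0 ≤ α) (hβ : 0 ≤ β) (hμ : 0 ≤ μ) (hμβ : μ ≤ 2 * β)
    (u : 𝓓(halfLine, ℂ)) {a b x y₁ y₂ : ℝ} (ha : 0 ≤ a) (hx : 0 < x) (hax : a ≤ x) (hxb : x ≤ b)
    (hab : a < b) (hy₁ : b - (b - a) / 2 ≤ y₁) (hy : y₁ + (b - a) / 4 ≤ y₂) (hy₂ : y₂ ≤ b) :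
    ‖kernelPart α β u b x‖ * x ^ (-μ / 2) ≤ 4 * 2 ^ α * 2 ^ β * (b - a) ^ (-μ / 2) *
      (‖kernelPart α β u b y₁‖ + ‖kernelPart α β u b y₂‖) := by
  have hb : 0 < b := ha.trans_lt hab
  have hquot : ‖quotKernelPart α β u b x‖ ≤ 4 * 2 ^ α * ((b / 2) ^ (-β) *
      ‖kernelPart α β u b y₁‖ + (b / 2) ^ (-β) * ‖kernelPart α β u b y₂‖) :=
    (norm_quotKernelPart_le hα u ha hax hxb hab hy₁ hy hy₂).trans
      (mul_le_mul_of_nonneg_left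
        (add_le_add (norm_quotKernelPart_le_norm_kernelPart α hβ u hb (by linarith))
          (norm_quotKernelPart_le_norm_kernelPart α hβ u hb (by linarith))) (by positivity))
  have hpow : b ^ (β + -μ / 2) * (b / 2) ^ (-β) = 2 ^ β * b ^ (-μ / 2) := by
    rw [Real.rpow_add hb, rpow_eq_two_rpow_mul_half_rpow β hb.le, Real.rpow_neg (by positivity)]
    field_simp
  calc ‖kernelPart α β u b x‖ * x ^ (-μ / 2)
      = x ^ (β + -μ / 2) * ‖quotKernelPart α β u b x‖ := by
        rw [norm_kernelPart α β u b hx.le, Real.rpow_add hx]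
        ring
    _ ≤ b ^ (β + -μ / 2) * (4 * 2 ^ α * ((b / 2) ^ (-β) * ‖kernelPart α β u b y₁‖ +
          (b / 2) ^ (-β) * ‖kernelPart α β u b y₂‖)) :=
        mul_le_mul (Real.rpow_le_rpow hx.le hxb (by linarith)) hquot (norm_nonneg _)
          (by positivity)
    _ = 4 * 2 ^ α * 2 ^ β * b ^ (-μ / 2) *
          (‖kernelPart α β u b y₁‖ + ‖kernelPart α β u b y₂‖) := by
        linear_combination (4 * 2 ^ α *
          (‖kernelPart α β u b y₁‖ + ‖kernelPart α β u b y₂‖)) * hpow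
    _ ≤ 4 * 2 ^ α * 2 ^ β * (b - a) ^ (-μ / 2) *
          (‖kernelPart α β u b y₁‖ + ‖kernelPart α β u b y₂‖) := by
        have hdecr : b ^ (-μ / 2) ≤ (b - a) ^ (-μ / 2) :=
          Real.rpow_le_rpow_of_nonpos (sub_pos.2 hab) (by linarith) (by linarith)
        gcongr

theorem exists_norm_sq_mul_le (u : 𝓓(halfLine, ℂ)) {a b c d : ℝ} (hac : a ≤ c) (hcd : c ≤ d)
    (hdb : d ≤ b) : ∃ y ∈ Icc c d, ‖u y‖ ^ 2 * (d - c) ≤ ∫ z in a..b, ‖u z‖ ^ 2 := by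
  have hcont : Continuous fun z => ‖u z‖ ^ 2 := u.continuous.norm.pow 2
  obtain ⟨y, hy, hmin⟩ := isCompact_Icc.exists_isMinOn (nonempty_Icc.2 hcd) hcont.continuousOn
  have hmean := intervalIntegral.integral_mono_on (μ := volume) (f := fun _ => ‖u y‖ ^ 2) hcd
    intervalIntegrable_const (hcont.intervalIntegrable c d) fun t ht => hmin ht
  rw [intervalIntegral.integral_const, smul_eq_mul, mul_comm] at hmean
  exact ⟨y, hy, hmean.trans (intervalIntegral.integral_mono_interval hac hcd hdb
    (Eventually.of_forall fun z => by positivity) (hcont.intervalIntegrable a b))⟩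

/-- The energy `∫_a^b |Lu|² + (b - a)⁻⁴ ∫_a^b |u|²` of `u` on `[a, b]`, where `L = diffOp α β`; the
two terms scale alike. -/
def intervalEnergy (α β : ℝ) (u : 𝓓(halfLine, ℂ)) (a b : ℝ) : ℝ :=
  (∫ z in a..b, ‖diffOp α β u z‖ ^ 2) + (b - a) ^ (-4 : ℝ) * ∫ z in a..b, ‖u z‖ ^ 2

theorem integral_norm_sq_nonneg (v : 𝓓(halfLine, ℂ)) {a b : ℝ} (hab : a ≤ b) :
    0 ≤ ∫ z in a..b, ‖v z‖ ^ 2 :=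
  intervalIntegral.integral_nonneg hab fun z _ => by positivity

theorem integral_norm_diffOp_sq_le_intervalEnergy (α β : ℝ) (u : 𝓓(halfLine, ℂ)) {a b : ℝ}
    (hab : a ≤ b) : ∫ z in a..b, ‖diffOp α β u z‖ ^ 2 ≤ intervalEnergy α β u a b :=
  le_add_of_nonneg_right
    (mul_nonneg (Real.rpow_nonneg (sub_nonneg.2 hab) _) (integral_norm_sq_nonneg u hab))

theorem intervalEnergy_nonneg (α β : ℝ) (u : 𝓓(halfLine, ℂ)) {a b : ℝ} (hab : a ≤ b) :
    0 ≤ intervalEnergy α β u a b :=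
  (integral_norm_sq_nonneg (diffOp α β u) hab).trans
    (integral_norm_diffOp_sq_le_intervalEnergy α β u hab)

theorem norm_kernelPart_sq_le (hα : 0 ≤ α) (hβ : 0 ≤ β) (u : 𝓓(halfLine, ℂ)) {a b y : ℝ}
    (hy0 : 0 < y) (hay : a ≤ y) (hyb : y ≤ b) (hab : a < b)
    (hy : ‖u y‖ ^ 2 * ((b - a) / 8) ≤ ∫ z in a..b, ‖u z‖ ^ 2) :
    ‖kernelPart α β u b y‖ ^ 2 ≤ 16 * ((b - a) ^ 3 * intervalEnergy α β u a b) := by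
  have hba : 0 < b - a := sub_pos.2 hab
  have hrem := norm_sub_kernelPart_sq_mul_rpow_le (β := β) hα le_rfl three_pos (by linarith) u
    hy0 hay hyb
  rw [neg_zero, Real.rpow_zero, mul_one, sub_zero, Real.rpow_ofNat] at hrem
  have hsplit : ‖kernelPart α β u b y‖ ^ 2 ≤
      2 * (‖u y‖ ^ 2 + ‖u y - kernelPart α β u b y‖ ^ 2) := by
    have htri := norm_sub_le (u y) (u y - kernelPart α β u b y)
    rw [sub_sub_cancel] at htri
    exact (pow_le_pow_left₀ (norm_nonneg _) htri 2).trans add_sq_le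
  have huy : ‖u y‖ ^ 2 ≤ 8 * ((b - a) ^ 3 * ((b - a) ^ (-4 : ℝ) * ∫ z in a..b, ‖u z‖ ^ 2)) := by
    refine ((le_div_iff₀ (by positivity)).2 hy).trans_eq ?_
    rw [Real.rpow_neg hba.le, Real.rpow_ofNat]
    field_simp
  have henergy := mul_nonneg (pow_nonneg hba.le 3) (integral_norm_sq_nonneg (diffOp α β u) hab.le)
  rw [intervalEnergy]
  linarith

/-- The constant in the weighted Sobolev inequality `norm_sq_mul_rpow_le` on intervals. -/
def sobolevConst (α β μ : ℝ) : ℝ := 2 / (3 - μ) + 128 * (4 * 2 ^ α * 2 ^ β) ^ 2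

theorem norm_kernelPart_sq_mul_rpow_le (hα : 0 ≤ α) (hβ : 0 ≤ β) (hμ : 0 ≤ μ)
    (hμβ : μ ≤ 2 * β) (u : 𝓓(halfLine, ℂ)) {a b x : ℝ} (ha : 0 ≤ a) (hx : 0 < x) (hax : a ≤ x)
    (hxb : x ≤ b) (hab : a < b) :
    ‖kernelPart α β u b x‖ ^ 2 * x ^ (-μ) ≤
      64 * (4 * 2 ^ α * 2 ^ β) ^ 2 * (b - a) ^ (3 - μ) * intervalEnergy α β u a b := by
  have hba : 0 < b - a := sub_pos.2 hab
  obtain ⟨y₁, hy₁, hu₁⟩ := exists_norm_sq_mul_le u (a := a) (b := b) (c := b - (b - a) / 2)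
    (d := b - 3 * (b - a) / 8) (by linarith) (by linarith) (by linarith)
  obtain ⟨y₂, hy₂, hu₂⟩ := exists_norm_sq_mul_le u (a := a) (b := b) (c := b - (b - a) / 8)
    (d := b) (by linarith) (by linarith) le_rfl
  have hK₁ := norm_kernelPart_sq_le hα hβ u (y := y₁) (by linarith [hy₁.1]) (by linarith [hy₁.1])
    (by linarith [hy₁.2]) hab (le_of_eq_of_le (by ring) hu₁)
  have hK₂ := norm_kernelPart_sq_le hα hβ u (y := y₂) (by linarith [hy₂.1]) (by linarith [hy₂.1])
    hy₂.2 hab (le_of_eq_of_le (by ring) hu₂)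
  have hKx := norm_kernelPart_mul_rpow_le hα hβ hμ hμβ u ha hx hax hxb hab hy₁.1
    (by linarith [hy₁.2, hy₂.1]) hy₂.2
  have hsq : ∀ {t : ℝ}, 0 < t → (t ^ (-μ / 2)) ^ 2 = t ^ (-μ) := fun ht => by
    rw [rpow_sq_eq_rpow_two_mul _ ht.le, mul_div_cancel₀ _ two_ne_zero]
  calc ‖kernelPart α β u b x‖ ^ 2 * x ^ (-μ) = (‖kernelPart α β u b x‖ * x ^ (-μ / 2)) ^ 2 := by
        rw [mul_pow, hsq hx]
    _ ≤ (4 * 2 ^ α * 2 ^ β * (b - a) ^ (-μ / 2) *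
          (‖kernelPart α β u b y₁‖ + ‖kernelPart α β u b y₂‖)) ^ 2 :=
        pow_le_pow_left₀ (by positivity) hKx 2
    _ = (4 * 2 ^ α * 2 ^ β) ^ 2 * (b - a) ^ (-μ) *
          (‖kernelPart α β u b y₁‖ + ‖kernelPart α β u b y₂‖) ^ 2 := by
        rw [mul_pow, mul_pow _ ((b - a) ^ (-μ / 2)), hsq hba]
    _ ≤ (4 * 2 ^ α * 2 ^ β) ^ 2 * (b - a) ^ (-μ) *
          (64 * ((b - a) ^ 3 * intervalEnergy α β u a b)) := by
        refine mul_le_mul_of_nonneg_left ?_ (by positivity)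
        linarith [add_sq_le (a := ‖kernelPart α β u b y₁‖) (b := ‖kernelPart α β u b y₂‖)]
    _ = 64 * (4 * 2 ^ α * 2 ^ β) ^ 2 * (b - a) ^ (3 - μ) * intervalEnergy α β u a b := by
        rw [sub_eq_neg_add 3 μ, Real.rpow_add hba, Real.rpow_ofNat]
        ring

theorem norm_sq_mul_rpow_le (hα : 0 ≤ α) (hβ : 0 ≤ β) (hμ : 0 ≤ μ) (hμ3 : μ < 3)
    (hμβ : μ ≤ 2 * β) (u : 𝓓(halfLine, ℂ)) {a b x : ℝ} (ha : 0 ≤ a) (hx : 0 < x) (hax : a ≤ x)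
    (hxb : x ≤ b) (hab : a < b) :
    ‖u x‖ ^ 2 * x ^ (-μ) ≤
      sobolevConst α β μ * (b - a) ^ (3 - μ) * intervalEnergy α β u a b := by
  have hK := norm_kernelPart_sq_mul_rpow_le hα hβ hμ hμβ u ha hx hax hxb hab
  have hrem := (norm_sub_kernelPart_sq_mul_rpow_le hα hμ hμ3 hμβ u hx hax hxb).trans
    (mul_le_mul_of_nonneg_left (integral_norm_diffOp_sq_le_intervalEnergy α β u hab.le)
      (div_nonneg (Real.rpow_nonneg (sub_nonneg.2 hab.le) _) (by linarith)))
  have hsplit : ‖u x‖ ^ 2 ≤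
      2 * (‖u x - kernelPart α β u b x‖ ^ 2 + ‖kernelPart α β u b x‖ ^ 2) := by
    have htri := norm_add_le (u x - kernelPart α β u b x) (kernelPart α β u b x)
    rw [sub_add_cancel] at htri
    exact (pow_le_pow_left₀ (norm_nonneg _) htri 2).trans add_sq_le
  calc ‖u x‖ ^ 2 * x ^ (-μ)
      ≤ 2 * (‖u x - kernelPart α β u b x‖ ^ 2 + ‖kernelPart α β u b x‖ ^ 2) * x ^ (-μ) :=
        mul_le_mul_of_nonneg_right hsplit (by positivity)
    _ = 2 * (‖u x - kernelPart α β u b x‖ ^ 2 * x ^ (-μ)) +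
          2 * (‖kernelPart α β u b x‖ ^ 2 * x ^ (-μ)) := by ring
    _ ≤ 2 * ((b - a) ^ (3 - μ) / (3 - μ) * intervalEnergy α β u a b) +
          2 * (64 * (4 * 2 ^ α * 2 ^ β) ^ 2 * (b - a) ^ (3 - μ) * intervalEnergy α β u a b) := by
        gcongr
    _ = sobolevConst α β μ * (b - a) ^ (3 - μ) * intervalEnergy α β u a b := by
        rw [sobolevConst]
        ring

theorem sobolevConst_pos (α β : ℝ) (hμ3 : μ < 3) : 0 < sobolevConst α β μ :=
  add_pos (div_pos two_pos (sub_pos.2 hμ3)) (by positivity)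

theorem norm_sq_mul_rpow_le_of_cauchyData (hα : 0 ≤ α) (hμ : 0 ≤ μ) (hμ3 : μ < 3)
    (hμβ : μ ≤ 2 * β) (u : 𝓓(halfLine, ℂ)) {a b x : ℝ} (hx : 0 < x) (hax : a ≤ x)
    (hxb : x ≤ b) (hquotFn : quotFn β u b = 0) (hquotDeriv : quotDeriv α β u b = 0) :
    ‖u x‖ ^ 2 * x ^ (-μ) ≤ sobolevConst α β μ * (b - a) ^ (3 - μ) *
      ∫ z in a..b, ‖diffOp α β u z‖ ^ 2 := by
  have hkernel : kernelPart α β u b x = 0 := by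
    rw [kernelPart, quotKernelPart, hquotFn, hquotDeriv, smul_zero, sub_zero, smul_zero]
  have hconst : 1 / (3 - μ) ≤ sobolevConst α β μ := by
    have hpos : 0 ≤ 1 / (3 - μ) := one_div_nonneg.2 (by linarith)
    rw [sobolevConst, div_eq_mul_one_div 2]
    linarith [sq_nonneg ((4 : ℝ) * 2 ^ α * 2 ^ β)]
  have hrem := norm_sub_kernelPart_sq_mul_rpow_le hα hμ hμ3 hμβ u hx hax hxb
  rw [hkernel, sub_zero, div_eq_mul_one_div, mul_comm ((b - a) ^ (3 - μ))] at hrem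
  exact hrem.trans (mul_le_mul_of_nonneg_right (mul_le_mul_of_nonneg_right hconst
    (Real.rpow_nonneg (by linarith) _)) (integral_norm_sq_nonneg _ (hax.trans hxb)))

end Sobolev

section Partition

variable {Φ J : ℝ → ℝ} {θ κ M δ : ℝ}

theorem exists_gt_rpow_mul_sub_eq (hΦ : Continuous Φ) (hmono : StrictMono Φ) (hθ : 0 < θ)
    (hκ : 0 < κ) (a : ℝ) : ∃ b, a < b ∧ (b - a) ^ θ * (Φ b - Φ a) = κ := by
  have hgain : 0 < Φ (a + 1) - Φ a := sub_pos.2 (hmono (lt_add_one a))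
  obtain ⟨T, hT, hT1⟩ := ((tendsto_rpow_atTop hθ).eventually_ge_atTop (κ / (Φ (a + 1) - Φ a)) |>.and
    (eventually_ge_atTop 1)).exists
  have hcont : Continuous fun b => (b - a) ^ θ * (Φ b - Φ a) :=
    ((Real.continuous_rpow_const hθ.le).comp (continuous_id.sub continuous_const)).mul
      (hΦ.sub continuous_const)
  have hleft : (a - a) ^ θ * (Φ a - Φ a) < κ := by rwa [sub_self (Φ a), mul_zero]
  have hright : κ ≤ (a + T - a) ^ θ * (Φ (a + T) - Φ a) := by
    rw [add_sub_cancel_left]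
    exact ((div_le_iff₀ hgain).1 hT).trans (mul_le_mul_of_nonneg_left
      (sub_le_sub_right (hmono.monotone (add_le_add_right hT1 a)) _)
      (Real.rpow_nonneg (by linarith) θ))
  obtain ⟨b, hb, hbκ⟩ := intermediate_value_Icc (by linarith : a ≤ a + T) hcont.continuousOn
    ⟨hleft.le, hright⟩
  refine ⟨b, hb.1.lt_of_ne ?_, hbκ⟩
  rintro rfl
  exact hleft.ne hbκ

theorem exists_strictMono_rpow_mul_sub_eq (hΦ : Continuous Φ) (hmono : StrictMono Φ) (hθ : 0 < θ)
    (hκ : 0 < κ) : ∃ t : ℕ → ℝ, t 0 = 0 ∧ StrictMono t ∧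
      ∀ k, (t (k + 1) - t k) ^ θ * (Φ (t (k + 1)) - Φ (t k)) = κ := by
  choose next hlt hnext using exists_gt_rpow_mul_sub_eq hΦ hmono hθ hκ
  have hsucc : ∀ k, next^[k + 1] 0 = next (next^[k] 0) := fun k =>
    Function.iterate_succ_apply' next k 0
  refine ⟨fun k => next^[k] 0, rfl, strictMono_nat_of_lt_succ fun k => ?_, fun k => ?_⟩
  · rw [hsucc]
    exact hlt _
  · beta_reduce
    rw [hsucc]
    exact hnext _

theorem le_sub_of_rpow_mul_sub_eq {a b : ℝ} (hab : a < b) (hθ : 0 < θ) (hκ : 0 < κ) (hM : 0 < M)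
    (hosc : Φ b - Φ a ≤ M) (hmass : (b - a) ^ θ * (Φ b - Φ a) = κ) :
    (κ / M) ^ θ⁻¹ ≤ b - a := by
  have hlength : 0 ≤ b - a := sub_nonneg.2 hab.le
  rw [Real.rpow_inv_le_iff_of_pos (div_pos hκ hM).le hlength hθ, div_le_iff₀ hM, ← hmass]
  exact mul_le_mul_of_nonneg_left hosc (Real.rpow_nonneg hlength θ)

theorem tendsto_atTop_of_le_sub_succ {t : ℕ → ℝ} {c : ℝ} (hc : 0 < c)
    (ht : ∀ k, c ≤ t (k + 1) - t k) : Tendsto t atTop atTop := by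
  have hlinear : ∀ n : ℕ, t 0 + n * c ≤ t n := fun n => by
    induction n with
    | zero => rw [Nat.cast_zero, zero_mul, add_zero]
    | succ n ih =>
      push_cast
      linarith [ht n]
  exact tendsto_atTop_mono hlinear (tendsto_atTop_add_const_left _ _
    (tendsto_natCast_atTop_atTop.atTop_mul_const hc))

theorem sum_inv_rpow_sub_le {t : ℕ → ℝ} (ht : StrictMono t) (hκ : 0 < κ)
    (hosc : ∀ k, Φ (t k) - Φ (t 0) ≤ M)
    (hmass : ∀ k, (t (k + 1) - t k) ^ θ * (Φ (t (k + 1)) - Φ (t k)) = κ) (n : ℕ) :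
    ∑ k ∈ Finset.range n, ((t (k + 1) - t k) ^ θ)⁻¹ ≤ M / κ := by
  have hterm : ∀ k, ((t (k + 1) - t k) ^ θ)⁻¹ = (Φ (t (k + 1)) - Φ (t k)) / κ := fun k => by
    have hpos : 0 < (t (k + 1) - t k) ^ θ :=
      Real.rpow_pos_of_pos (sub_pos.2 (ht k.lt_succ_self)) θ
    rw [eq_div_iff hκ.ne', ← hmass k, inv_mul_cancel_left₀ hpos.ne']
  simp_rw [hterm]
  rw [← Finset.sum_div, Finset.sum_range_sub (fun k => Φ (t k))]
  exact div_le_div_of_nonneg_right (hosc n) hκ.le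

/-- The distribution function `∫₀^x J` of the mass `J`, made strictly increasing at the cost of
an additional mass `δ`. -/
def regularizedMass (J : ℝ → ℝ) (δ x : ℝ) : ℝ := (∫ y in (0 : ℝ)..x, J y) + δ * Real.sigmoid x

theorem continuous_regularizedMass (hJ : Integrable J) (δ : ℝ) :
    Continuous (regularizedMass J δ) :=
  (intervalIntegral.continuous_primitive (fun _ _ => hJ.intervalIntegrable) 0).add
    (continuous_const.mul differentiable_sigmoid.continuous)

theorem regularizedMass_sub (hJ : Integrable J) (δ a b : ℝ) :
    regularizedMass J δ b - regularizedMass J δ a =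
      (∫ y in a..b, J y) + δ * (Real.sigmoid b - Real.sigmoid a) := by
  rw [← intervalIntegral.integral_interval_sub_left hJ.intervalIntegrable hJ.intervalIntegrable,
    regularizedMass, regularizedMass]
  ring

theorem integral_lt_regularizedMass_sub (hJ : Integrable J) (hδ : 0 < δ) {a b : ℝ} (hab : a < b) :
    ∫ y in a..b, J y < regularizedMass J δ b - regularizedMass J δ a := by
  rw [regularizedMass_sub hJ]
  exact lt_add_of_pos_right _ (mul_pos hδ (sub_pos.2 (Real.sigmoid_strictMono hab)))

theorem strictMono_regularizedMass (hJ : Integrable J) (hJ0 : 0 ≤ᵐ[volume] J) (hδ : 0 < δ) :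
    StrictMono (regularizedMass J δ) := fun _ _ hab =>
  sub_pos.1 ((intervalIntegral.integral_nonneg_of_ae hab.le hJ0).trans_lt
    (integral_lt_regularizedMass_sub hJ hδ hab))

theorem regularizedMass_sub_le (hJ : Integrable J) (hJ0 : 0 ≤ᵐ[volume] J) (hδ : 0 < δ) {a b : ℝ}
    (hab : a ≤ b) : regularizedMass J δ b - regularizedMass J δ a ≤ (∫ y, J y) + δ := by
  rw [regularizedMass_sub hJ, intervalIntegral.integral_of_le hab]
  refine add_le_add (setIntegral_le_integral hJ hJ0) (mul_le_of_le_one_right hδ.le ?_)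
  linarith [Real.sigmoid_le_one b, Real.sigmoid_pos a]

theorem exists_partition (hJ : Integrable J) (hJ0 : 0 ≤ᵐ[volume] J) (hθ : 0 < θ) (hκ : 0 < κ)
    (hδ : 0 < δ) :
    ∃ t : ℕ → ℝ, t 0 = 0 ∧ StrictMono t ∧ (∃ c, 0 < c ∧ ∀ k, c ≤ t (k + 1) - t k) ∧
      (∀ k, (t (k + 1) - t k) ^ θ * (∫ x in t k..t (k + 1), J x) ≤ κ) ∧
      ∀ n, ∑ k ∈ Finset.range n, ((t (k + 1) - t k) ^ θ)⁻¹ ≤ ((∫ x, J x) + δ) / κ := by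
  have htotal : 0 < (∫ x, J x) + δ := add_pos_of_nonneg_of_pos (integral_nonneg_of_ae hJ0) hδ
  obtain ⟨t, ht0, ht, hmass⟩ := exists_strictMono_rpow_mul_sub_eq
    (continuous_regularizedMass hJ δ) (strictMono_regularizedMass hJ hJ0 hδ) hθ hκ
  have hlt : ∀ k, t k < t (k + 1) := fun k => ht k.lt_succ_self
  refine ⟨t, ht0, ht, ⟨_, Real.rpow_pos_of_pos (div_pos hκ htotal) θ⁻¹, fun k => ?_⟩, fun k => ?_,
    sum_inv_rpow_sub_le ht hκ
      (fun k => regularizedMass_sub_le hJ hJ0 hδ (ht.monotone k.zero_le)) hmass⟩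
  · exact le_sub_of_rpow_mul_sub_eq (hlt k) hθ hκ htotal
      (regularizedMass_sub_le hJ hJ0 hδ (hlt k).le) (hmass k)
  · rw [← hmass k]
    exact mul_le_mul_of_nonneg_left (integral_lt_regularizedMass_sub hJ hδ (hlt k)).le
      (Real.rpow_nonneg (sub_nonneg.2 (hlt k).le) θ)

end Partition

section Potential

/-- A potential `V ≥ 0` on the half-line with `∫ V^p x^ν < ∞`, for an exponent `p ≥ 1`. The weight
`V x^{ν/p}` is then locally integrable up to the origin. -/
structure AdmissiblePotential (V : ℝ → ℝ) (p ν : ℝ) : Prop where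
  one_le : 1 ≤ p
  ae_nonneg : ∀ᵐ x ∂(volume.restrict (Ioi (0 : ℝ))), 0 ≤ V x
  integrableOn_rpow : IntegrableOn (fun x => V x ^ p * x ^ ν) (Ioi 0)

theorem le_add_rpow_one_sub_mul_rpow {p y τ : ℝ} (hp : 1 ≤ p) (hy : 0 ≤ y) (hτ : 0 < τ) :
    y ≤ τ + τ ^ (1 - p) * y ^ p := by
  rcases le_or_gt y τ with hyτ | hτy
  · exact hyτ.trans (le_add_of_nonneg_right (by positivity))
  · have hy0 : 0 < y := hτ.trans hτy
    calc y = y ^ (1 - p) * y ^ p := by rw [← Real.rpow_add hy0, sub_add_cancel, Real.rpow_one]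
      _ ≤ τ ^ (1 - p) * y ^ p := mul_le_mul_of_nonneg_right
          (Real.rpow_le_rpow_of_nonpos hτ hτy.le (by linarith)) (by positivity)
      _ ≤ τ + τ ^ (1 - p) * y ^ p := le_add_of_nonneg_left hτ.le

theorem mul_rpow_div_rpow {p ν v x : ℝ} (hp : p ≠ 0) (hv : 0 ≤ v) (hx : 0 ≤ x) :
    (v * x ^ (ν / p)) ^ p = v ^ p * x ^ ν := by
  rw [Real.mul_rpow hv (Real.rpow_nonneg hx _), ← Real.rpow_mul hx, div_mul_cancel₀ _ hp]

theorem mul_sq_eq_mul_rpow_mul (v s : ℝ) {x : ℝ} (hx : 0 < x) (y : ℝ) :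
    v * y ^ 2 = v * x ^ s * (y ^ 2 * x ^ (-s)) := by
  have hcancel : x ^ s * x ^ (-s) = 1 := by
    rw [← Real.rpow_add hx, add_neg_cancel, Real.rpow_zero]
  linear_combination -(v * y ^ 2) * hcancel

theorem norm_mulRpow_sq (s : ℝ) (u : 𝓓(halfLine, ℂ)) {x : ℝ} (hx : 0 < x) :
    ‖mulRpow s u x‖ ^ 2 = ‖u x‖ ^ 2 * x ^ (2 * s) := by
  rw [mulRpow_apply, norm_smul, mul_pow, Real.norm_of_nonneg (Real.rpow_nonneg hx.le s),
    rpow_sq_eq_rpow_two_mul s hx.le, mul_comm]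

theorem restrict_Ioc_le_restrict_Ioi {a : ℝ} (ha : 0 ≤ a) (b : ℝ) :
    volume.restrict (Ioc a b) ≤ volume.restrict (Ioi (0 : ℝ)) :=
  Measure.restrict_mono_set _ fun _ hx => ha.trans_lt hx.1

namespace AdmissiblePotential

variable {V : ℝ → ℝ} {p ν : ℝ}

theorem ae_weight_nonneg (h : AdmissiblePotential V p ν) :
    ∀ᵐ x ∂(volume.restrict (Ioi (0 : ℝ))), 0 ≤ V x * x ^ (ν / p) := by
  filter_upwards [h.ae_nonneg, ae_restrict_mem measurableSet_Ioi] with x hVx hx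
  exact mul_nonneg hVx (Real.rpow_nonneg (le_of_lt hx) _)

theorem ae_weight_le (h : AdmissiblePotential V p ν) {τ : ℝ} (hτ : 0 < τ) :
    ∀ᵐ x ∂(volume.restrict (Ioi (0 : ℝ))),
      V x * x ^ (ν / p) ≤ τ + τ ^ (1 - p) * (V x ^ p * x ^ ν) := by
  filter_upwards [h.ae_nonneg, h.ae_weight_nonneg, ae_restrict_mem measurableSet_Ioi] with
    x hVx hweight hx
  rw [← mul_rpow_div_rpow (by linarith [h.one_le]) hVx (le_of_lt hx)]
  exact le_add_rpow_one_sub_mul_rpow h.one_le hweight hτ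

theorem aemeasurable (h : AdmissiblePotential V p ν) :
    AEMeasurable V (volume.restrict (Ioi (0 : ℝ))) := by
  have hroot : AEMeasurable (fun x => (V x ^ p * x ^ ν * x ^ (-ν)) ^ p⁻¹)
      (volume.restrict (Ioi (0 : ℝ))) :=
    (h.integrableOn_rpow.aemeasurable.mul (by fun_prop)).pow_const _
  refine hroot.congr ?_
  filter_upwards [h.ae_nonneg, ae_restrict_mem measurableSet_Ioi] with x hVx hx
  rw [mul_assoc, ← Real.rpow_add hx, add_neg_cancel, Real.rpow_zero, mul_one,
    Real.rpow_rpow_inv hVx (by linarith [h.one_le])]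

theorem aemeasurable_weight (h : AdmissiblePotential V p ν) :
    AEMeasurable (fun x => V x * x ^ (ν / p)) (volume.restrict (Ioi (0 : ℝ))) :=
  h.aemeasurable.mul (by fun_prop)

theorem integrableOn_mul_norm_sq (h : AdmissiblePotential V p ν) (u : 𝓓(halfLine, ℂ)) :
    IntegrableOn (fun x => V x * ‖u x‖ ^ 2) (Ioi 0) := by
  let φ : ℝ → ℝ := fun x => ‖mulRpow (-(ν / p) / 2) u x‖ ^ 2
  have hφc : Continuous φ := (mulRpow (-(ν / p) / 2) u).continuous.norm.pow 2
  have hφs : HasCompactSupport φ :=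
    (mulRpow (-(ν / p) / 2) u).hasCompactSupport.comp_left (g := fun z : ℂ => ‖z‖ ^ 2) (by simp)
  obtain ⟨B, hB⟩ := hφc.bounded_above_of_compact_support hφs
  have hdom : IntegrableOn (fun x => φ x + (V x ^ p * x ^ ν) * φ x) (Ioi 0) :=
    (hφc.integrable_of_hasCompactSupport hφs).integrableOn.add
      (Integrable.mul_bdd h.integrableOn_rpow hφc.aestronglyMeasurable (Eventually.of_forall hB))
  refine Integrable.mono' hdom (h.aemeasurable.mul
    (u.continuous.norm.pow 2).aemeasurable).aestronglyMeasurable ?_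
  filter_upwards [h.ae_weight_nonneg, h.ae_weight_le one_pos, ae_restrict_mem measurableSet_Ioi]
    with x hweight hle hx
  rw [Real.one_rpow, one_mul] at hle
  have hφx : V x * ‖u x‖ ^ 2 = V x * x ^ (ν / p) * φ x := by
    simp only [φ]
    rw [mul_sq_eq_mul_rpow_mul _ (ν / p) hx, norm_mulRpow_sq _ _ hx, mul_div_cancel₀ _ two_ne_zero]
  rw [hφx, Real.norm_of_nonneg (mul_nonneg hweight (sq_nonneg _)), ← one_add_mul]
  exact mul_le_mul_of_nonneg_right hle (sq_nonneg _)

variable {a b : ℝ}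

theorem intervalIntegrable_rpow (h : AdmissiblePotential V p ν) (ha : 0 ≤ a) (hab : a ≤ b) :
    IntervalIntegrable (fun x => V x ^ p * x ^ ν) volume a b :=
  (intervalIntegrable_iff_integrableOn_Ioc_of_le hab).2
    (Integrable.mono_measure h.integrableOn_rpow (restrict_Ioc_le_restrict_Ioi ha b))

theorem intervalIntegrable_weight (h : AdmissiblePotential V p ν) (ha : 0 ≤ a) (hab : a ≤ b) :
    IntervalIntegrable (fun x => V x * x ^ (ν / p)) volume a b := by
  have hdom : IntegrableOn (fun x => 1 + 1 ^ (1 - p) * (V x ^ p * x ^ ν)) (Ioc a b) :=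
    (intervalIntegrable_iff_integrableOn_Ioc_of_le hab).1
      (intervalIntegrable_const.add ((h.intervalIntegrable_rpow ha hab).const_mul _))
  refine (intervalIntegrable_iff_integrableOn_Ioc_of_le hab).2 (Integrable.mono' hdom
    (h.aemeasurable_weight.mono_measure
      (restrict_Ioc_le_restrict_Ioi ha b)).aestronglyMeasurable ?_)
  filter_upwards [ae_mono (restrict_Ioc_le_restrict_Ioi ha b) h.ae_weight_nonneg,
    ae_mono (restrict_Ioc_le_restrict_Ioi ha b) (h.ae_weight_le one_pos)] with x hweight hle
  rwa [Real.norm_of_nonneg hweight]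

theorem integral_weight_le (h : AdmissiblePotential V p ν) (ha : 0 ≤ a) (hab : a ≤ b) {τ : ℝ}
    (hτ : 0 < τ) : ∫ x in a..b, V x * x ^ (ν / p) ≤
      (b - a) * τ + τ ^ (1 - p) * ∫ x in a..b, V x ^ p * x ^ ν := by
  have hdom := (h.intervalIntegrable_rpow ha hab).const_mul (τ ^ (1 - p))
  calc ∫ x in a..b, V x * x ^ (ν / p)
      ≤ ∫ x in a..b, (τ + τ ^ (1 - p) * (V x ^ p * x ^ ν)) := by
        rw [intervalIntegral.integral_of_le hab, intervalIntegral.integral_of_le hab]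
        exact integral_mono_ae ((h.intervalIntegrable_weight ha hab).1)
          (intervalIntegrable_const.add hdom).1
          (ae_mono (restrict_Ioc_le_restrict_Ioi ha b) (h.ae_weight_le hτ))
    _ = (b - a) * τ + τ ^ (1 - p) * ∫ x in a..b, V x ^ p * x ^ ν := by
        rw [intervalIntegral.integral_add intervalIntegrable_const hdom,
          intervalIntegral.integral_const, smul_eq_mul, intervalIntegral.integral_const_mul]

theorem rpow_mul_integral_weight_le (h : AdmissiblePotential V p ν) (ha : 0 ≤ a) (hab : a < b)
    {ε : ℝ} (hε : 0 < ε)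
    (hmass : (b - a) ^ (4 * p - 1 - ν) * (∫ x in a..b, V x ^ p * x ^ ν) ≤ ε ^ p) :
    (b - a) ^ (3 - ν / p) * (∫ x in a..b, V x * x ^ (ν / p)) ≤ 2 * ε := by
  have hl : 0 < b - a := sub_pos.2 hab
  have hνp : ν / p * p = ν := div_mul_cancel₀ ν (by linarith [h.one_le])
  -- The threshold at which both terms of `integral_weight_le` are of order `ε`.
  let τ := ε * (b - a) ^ (ν / p - 4)
  have hτ : 0 < τ := by positivity
  have hfirst : (b - a) ^ (3 - ν / p) * ((b - a) * τ) = ε := by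
    have hone : (b - a) ^ (3 - ν / p) * (b - a) * (b - a) ^ (ν / p - 4) = 1 := by
      rw [← Real.rpow_add_one hl.ne', ← Real.rpow_add hl,
        show 3 - ν / p + 1 + (ν / p - 4) = 0 by ring, Real.rpow_zero]
    linear_combination ε * hone
  have hsecond : (b - a) ^ (3 - ν / p) * τ ^ (1 - p) =
      ε ^ (1 - p) * (b - a) ^ (4 * p - 1 - ν) := by
    rw [Real.mul_rpow hε.le (by positivity), ← Real.rpow_mul hl.le, mul_left_comm,
      ← Real.rpow_add hl]
    congr 2
    linear_combination -hνp
  calc (b - a) ^ (3 - ν / p) * ∫ x in a..b, V x * x ^ (ν / p)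
      ≤ (b - a) ^ (3 - ν / p) * ((b - a) * τ + τ ^ (1 - p) * ∫ x in a..b, V x ^ p * x ^ ν) :=
        mul_le_mul_of_nonneg_left (h.integral_weight_le ha hab.le hτ) (by positivity)
    _ = ε + ε ^ (1 - p) * ((b - a) ^ (4 * p - 1 - ν) * ∫ x in a..b, V x ^ p * x ^ ν) := by
        linear_combination hfirst + (∫ x in a..b, V x ^ p * x ^ ν) * hsecond
    _ ≤ ε + ε ^ (1 - p) * ε ^ p :=
        add_le_add_right (mul_le_mul_of_nonneg_left hmass (by positivity)) ε
    _ = 2 * ε := by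
        rw [← Real.rpow_add hε, sub_add_cancel, Real.rpow_one, two_mul]

theorem integral_mul_norm_sq_le (h : AdmissiblePotential V p ν) (u : 𝓓(halfLine, ℂ)) {K Z : ℝ}
    (ha : 0 ≤ a) (hab : a < b) (hK : 0 < K) (hZ : 0 ≤ Z)
    (hmass : (b - a) ^ (4 * p - 1 - ν) * (∫ x in a..b, V x ^ p * x ^ ν) ≤ (1 / (4 * K)) ^ p)
    (hu : ∀ x ∈ Ioc a b, ‖u x‖ ^ 2 * x ^ (-(ν / p)) ≤ K * (b - a) ^ (3 - ν / p) * Z) :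
    ∫ x in a..b, V x * ‖u x‖ ^ 2 ≤ 1 / 2 * Z := by
  have hpointwise : ∀ᵐ x ∂(volume.restrict (Ioc a b)), V x * ‖u x‖ ^ 2 ≤
      V x * x ^ (ν / p) * (K * (b - a) ^ (3 - ν / p) * Z) := by
    filter_upwards [ae_mono (restrict_Ioc_le_restrict_Ioi ha b) h.ae_weight_nonneg,
      ae_restrict_mem measurableSet_Ioc] with x hweight hx
    rw [mul_sq_eq_mul_rpow_mul _ (ν / p) (ha.trans_lt hx.1)]
    exact mul_le_mul_of_nonneg_left (hu x hx) hweight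
  calc ∫ x in a..b, V x * ‖u x‖ ^ 2
      ≤ ∫ x in a..b, V x * x ^ (ν / p) * (K * (b - a) ^ (3 - ν / p) * Z) := by
        rw [intervalIntegral.integral_of_le hab.le, intervalIntegral.integral_of_le hab.le]
        exact integral_mono_ae
          (Integrable.mono_measure (h.integrableOn_mul_norm_sq u)
            (restrict_Ioc_le_restrict_Ioi ha b))
          ((h.intervalIntegrable_weight ha hab.le).mul_const _).1 hpointwise
    _ = K * Z * ((b - a) ^ (3 - ν / p) * ∫ x in a..b, V x * x ^ (ν / p)) := by
        rw [intervalIntegral.integral_mul_const]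
        ring
    _ ≤ K * Z * (2 * (1 / (4 * K))) := mul_le_mul_of_nonneg_left
        (h.rpow_mul_integral_weight_le ha hab (by positivity) hmass) (by positivity)
    _ = 1 / 2 * Z := by
        field_simp
        norm_num

end AdmissiblePotential

end Potential

section PotentialMap

namespace AdmissiblePotential

variable {V : ℝ → ℝ} {p ν : ℝ}

theorem memLp_sqrt_smul (h : AdmissiblePotential V p ν) (u : 𝓓(halfLine, ℂ)) :
    MemLp (fun x => √(V x) • u x) 2 (volume.restrict (Ioi (0 : ℝ))) := by
  have hmeas : AEStronglyMeasurable (fun x => √(V x) • u x) (volume.restrict (Ioi (0 : ℝ))) :=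
    (Real.continuous_sqrt.measurable.comp_aemeasurable h.aemeasurable).aestronglyMeasurable.smul
      u.continuous.aestronglyMeasurable
  rw [memLp_two_iff_integrable_sq_norm hmeas]
  refine (h.integrableOn_mul_norm_sq u).congr ?_
  filter_upwards [h.ae_nonneg] with x hVx
  rw [norm_smul, mul_pow, Real.norm_of_nonneg (Real.sqrt_nonneg _), Real.sq_sqrt hVx]

/-- The map `u ↦ V^{1/2} u` from `C₀^∞(0, ∞)` to `L²(0, ∞)`, through which the potential enters the
form. -/
def sqrtMul (h : AdmissiblePotential V p ν) : 𝓓(halfLine, ℂ) →ₗ[ℂ] L2HalfLine where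
  toFun u := (h.memLp_sqrt_smul u).toLp
  map_add' u v := by
    rw [← MemLp.toLp_add]
    exact MemLp.toLp_congr _ _ (Eventually.of_forall fun x => smul_add √(V x) (u x) (v x))
  map_smul' c u := by
    rw [RingHom.id_apply, ← MemLp.toLp_const_smul]
    exact MemLp.toLp_congr _ _ (Eventually.of_forall fun x => smul_comm √(V x) c (u x))

theorem norm_sqrtMul_sq (h : AdmissiblePotential V p ν) (u : 𝓓(halfLine, ℂ)) :
    ‖h.sqrtMul u‖ ^ 2 = ∫ x in Ioi (0 : ℝ), V x * ‖u x‖ ^ 2 := by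
  refine (norm_toLp_sq (h.memLp_sqrt_smul u)).trans (integral_congr_ae ?_)
  filter_upwards [h.ae_nonneg] with x hVx
  rw [norm_smul, mul_pow, Real.norm_of_nonneg (Real.sqrt_nonneg _), Real.sq_sqrt hVx]

theorem halfLineForm_eq (h : AdmissiblePotential V p ν) (α β : ℝ) (u : 𝓓(halfLine, ℂ)) :
    halfLineForm α β V u = ‖testToL2 (diffOp α β u)‖ ^ 2 - ‖h.sqrtMul u‖ ^ 2 := by
  rw [norm_testToL2_sq, norm_sqrtMul_sq, halfLineForm, ← integral_sub
    ((testFunction_memLp (diffOp α β u)).integrable_norm_pow two_ne_zero)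
    (h.integrableOn_mul_norm_sq u)]
  refine setIntegral_congr_fun measurableSet_Ioi fun x hx => ?_
  rw [norm_diffOp_sq α β u hx]

end AdmissiblePotential

end PotentialMap

section AdaptedPartition

variable {α β p ν : ℝ} {V : ℝ → ℝ} {t : ℕ → ℝ}

/-- The points `0 = t₀ < t₁ < ⋯ → ∞` cut the half-line into the intervals `(t k, t (k + 1)]`. -/
structure IsHalfLinePartition (t : ℕ → ℝ) : Prop where
  zero : t 0 = 0
  strictMono : StrictMono t
  tendsto_atTop : Tendsto t atTop atTop

theorem IsHalfLinePartition.lt_succ (ht : IsHalfLinePartition t) (k : ℕ) : t k < t (k + 1) :=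
  ht.strictMono k.lt_succ_self

theorem IsHalfLinePartition.nonneg (ht : IsHalfLinePartition t) (k : ℕ) : 0 ≤ t k :=
  ht.zero ▸ ht.strictMono.monotone k.zero_le

theorem IsHalfLinePartition.setIntegral_Ioi_eq_sum (ht : IsHalfLinePartition t) {f : ℝ → ℝ}
    (hf : IntegrableOn f (Ioi 0)) {n : ℕ} (hn : ∀ x, t n < x → f x = 0) :
    ∫ x in Ioi (0 : ℝ), f x = ∑ k ∈ Finset.range n, ∫ x in t k..t (k + 1), f x := by
  have htruncate : ∫ x in Ioi (0 : ℝ), f x = ∫ x in Ioc 0 (t n), f x :=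
    setIntegral_eq_of_subset_of_forall_sdiff_eq_zero measurableSet_Ioi (fun x hx => hx.1)
      fun x hx => hn x (not_le.1 fun hle => hx.2 ⟨hx.1, hle⟩)
  have hint : ∀ k < n, IntervalIntegrable f volume (t k) (t (k + 1)) := fun k _ =>
    (intervalIntegrable_iff_integrableOn_Ioc_of_le (ht.lt_succ k).le).2
      (hf.mono_set fun x hx => (ht.nonneg k).trans_lt hx.1)
  rw [intervalIntegral.sum_integral_adjacent_intervals hint, ht.zero,
    intervalIntegral.integral_of_le (ht.nonneg n), htruncate]

theorem exists_forall_gt_eq_zero (u : 𝓓(halfLine, ℂ)) : ∃ T : ℝ, ∀ x, T < x → u x = 0 := by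
  obtain ⟨T, hT⟩ := u.hasCompactSupport.isCompact.bddAbove
  exact ⟨T, fun x hx => image_eq_zero_of_notMem_tsupport fun hmem => (hT hmem).not_gt hx⟩

theorem IsHalfLinePartition.norm_sqrtMul_sq_le (ht : IsHalfLinePartition t)
    (h : AdmissiblePotential V p ν) (u v : 𝓓(halfLine, ℂ)) {c E : ℝ}
    (hinterval : ∀ k, ∫ x in t k..t (k + 1), V x * ‖u x‖ ^ 2 ≤
      c * (∫ x in t k..t (k + 1), ‖v x‖ ^ 2) + E * ∫ x in t k..t (k + 1), ‖u x‖ ^ 2) :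
    ‖h.sqrtMul u‖ ^ 2 ≤ c * ‖testToL2 v‖ ^ 2 + E * ‖testToL2 u‖ ^ 2 := by
  obtain ⟨Tu, hTu⟩ := exists_forall_gt_eq_zero u
  obtain ⟨Tv, hTv⟩ := exists_forall_gt_eq_zero v
  obtain ⟨n, hn⟩ := (ht.tendsto_atTop.eventually_ge_atTop (max Tu Tv)).exists
  have hu : ∀ x, t n < x → u x = 0 := fun x hx => hTu x ((max_le_iff.1 hn).1.trans_lt hx)
  have hv : ∀ x, t n < x → v x = 0 := fun x hx => hTv x ((max_le_iff.1 hn).2.trans_lt hx)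
  rw [h.norm_sqrtMul_sq, norm_testToL2_sq, norm_testToL2_sq,
    ht.setIntegral_Ioi_eq_sum (n := n) (h.integrableOn_mul_norm_sq u)
      (fun x hx => by simp [hu x hx]),
    ht.setIntegral_Ioi_eq_sum (n := n) ((testFunction_memLp v).integrable_norm_pow two_ne_zero)
      (fun x hx => by simp [hv x hx]),
    ht.setIntegral_Ioi_eq_sum (n := n) ((testFunction_memLp u).integrable_norm_pow two_ne_zero)
      (fun x hx => by simp [hu x hx]), Finset.mul_sum, Finset.mul_sum, ← Finset.sum_add_distrib]
  exact Finset.sum_le_sum fun k _ => hinterval k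

/-- The Cauchy data `(u / x^β, x^{-α} (u / x^β)')` at `b`, which determine the solutions of
`diffOp α β u = 0`. -/
def cauchyData (α β b : ℝ) : 𝓓(halfLine, ℂ) →ₗ[ℂ] ℂ × ℂ where
  toFun u := (quotFn β u b, quotDeriv α β u b)
  map_add' u v := by simp
  map_smul' c u := by simp

/-- A partition of the half-line adapted to the potential `V`: on each of its intervals `V` is
dominated by the energy of `intervalEnergy`, and by its leading term alone on functions without
Cauchy data at the right end point. -/
structure AdaptedPartition (α β : ℝ) (V : ℝ → ℝ) (t : ℕ → ℝ) : Prop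
    extends IsHalfLinePartition t where
  integral_le (k : ℕ) (u : 𝓓(halfLine, ℂ)) : ∫ x in t k..t (k + 1), V x * ‖u x‖ ^ 2 ≤
    1 / 2 * intervalEnergy α β u (t k) (t (k + 1))
  integral_le_of_cauchyData (k : ℕ) (u : 𝓓(halfLine, ℂ)) :
    cauchyData α β (t (k + 1)) u = 0 → ∫ x in t k..t (k + 1), V x * ‖u x‖ ^ 2 ≤
      1 / 2 * ∫ x in t k..t (k + 1), ‖diffOp α β u x‖ ^ 2

/-- The bound on the scale-invariant mass `(b - a)^{4p-1-ν} ∫_a^b V^p x^ν` below which the Sobolev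
inequality on `[a, b]` absorbs half of the energy. -/
def massThreshold (α β ν p : ℝ) : ℝ := (1 / (4 * sobolevConst α β (ν / p))) ^ p

theorem massThreshold_pos (α β : ℝ) (hμ3 : ν / p < 3) : 0 < massThreshold α β ν p := by
  have := sobolevConst_pos α β hμ3
  rw [massThreshold]
  positivity

theorem IsHalfLinePartition.adaptedPartition (ht : IsHalfLinePartition t) (hα : 0 ≤ α)
    (hβ : 0 ≤ β) (hμ : 0 ≤ ν / p) (hμ3 : ν / p < 3) (hμβ : ν / p ≤ 2 * β)
    (h : AdmissiblePotential V p ν)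
    (hmass : ∀ k, (t (k + 1) - t k) ^ (4 * p - 1 - ν) *
      (∫ x in t k..t (k + 1), V x ^ p * x ^ ν) ≤ massThreshold α β ν p) :
    AdaptedPartition α β V t where
  toIsHalfLinePartition := ht
  integral_le k u := h.integral_mul_norm_sq_le u (ht.nonneg k) (ht.lt_succ k)
    (sobolevConst_pos α β hμ3) (intervalEnergy_nonneg α β u (ht.lt_succ k).le) (hmass k)
    fun _ hx => norm_sq_mul_rpow_le hα hβ hμ hμ3 hμβ u (ht.nonneg k)
      ((ht.nonneg k).trans_lt hx.1) hx.1.le hx.2 (ht.lt_succ k)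
  integral_le_of_cauchyData k u hdata := h.integral_mul_norm_sq_le u (ht.nonneg k) (ht.lt_succ k)
    (sobolevConst_pos α β hμ3) (integral_norm_sq_nonneg _ (ht.lt_succ k).le) (hmass k)
    fun _ hx => norm_sq_mul_rpow_le_of_cauchyData hα hμ hμ3 hμβ u
      ((ht.nonneg k).trans_lt hx.1) hx.1.le hx.2 (Prod.mk_eq_zero.1 hdata).1
      (Prod.mk_eq_zero.1 hdata).2

theorem AdmissiblePotential.exists_partition (h : AdmissiblePotential V p ν) {θ κ δ : ℝ}
    (hθ : 0 < θ) (hκ : 0 < κ) (hδ : 0 < δ) :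
    ∃ t : ℕ → ℝ, IsHalfLinePartition t ∧ (∃ c, 0 < c ∧ ∀ k, c ≤ t (k + 1) - t k) ∧
      (∀ k, (t (k + 1) - t k) ^ θ * (∫ x in t k..t (k + 1), V x ^ p * x ^ ν) ≤ κ) ∧
      ∀ n, ∑ k ∈ Finset.range n, ((t (k + 1) - t k) ^ θ)⁻¹ ≤
        ((∫ x in Ioi (0 : ℝ), V x ^ p * x ^ ν) + δ) / κ := by
  let J : ℝ → ℝ := (Ioi (0 : ℝ)).indicator fun x => V x ^ p * x ^ ν
  have hJ : Integrable J := (integrable_indicator_iff measurableSet_Ioi).2 h.integrableOn_rpow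
  have hJ0 : 0 ≤ᵐ[volume] J := by
    filter_upwards [(ae_restrict_iff' measurableSet_Ioi).1 h.ae_nonneg] with x hVx
    exact indicator_apply_nonneg fun hx =>
      mul_nonneg (Real.rpow_nonneg (hVx hx) p) (Real.rpow_nonneg (le_of_lt hx) ν)
  obtain ⟨t, ht0, ht, ⟨c, hc, hct⟩, hmass, hsum⟩ := _root_.exists_partition hJ hJ0 hθ hκ hδ
  have hpart : IsHalfLinePartition t := ⟨ht0, ht, tendsto_atTop_of_le_sub_succ hc hct⟩
  have hJt : ∀ k, ∫ x in t k..t (k + 1), J x = ∫ x in t k..t (k + 1), V x ^ p * x ^ ν :=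
    fun k => intervalIntegral.integral_congr_ae (Eventually.of_forall fun x hx =>
      indicator_of_mem ((hpart.nonneg k).trans_lt (uIoc_of_le (hpart.lt_succ k).le ▸ hx).1) _)
  rw [integral_indicator measurableSet_Ioi] at hsum
  exact ⟨t, hpart, ⟨c, hc, hct⟩, fun k => hJt k ▸ hmass k, hsum⟩

theorem AdaptedPartition.norm_sqrtMul_sq_le (ht : AdaptedPartition α β V t)
    (h : AdmissiblePotential V p ν) {c : ℝ} (hc : 0 < c) (hct : ∀ k, c ≤ t (k + 1) - t k)
    (u : 𝓓(halfLine, ℂ)) : ‖h.sqrtMul u‖ ^ 2 ≤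
      1 / 2 * ‖testToL2 (diffOp α β u)‖ ^ 2 + c ^ (-4 : ℝ) * ‖testToL2 u‖ ^ 2 := by
  refine ht.toIsHalfLinePartition.norm_sqrtMul_sq_le h u _ fun k => (ht.integral_le k u).trans ?_
  have hmass := integral_norm_sq_nonneg u (ht.lt_succ k).le
  have hlevel : (t (k + 1) - t k) ^ (-4 : ℝ) ≤ c ^ (-4 : ℝ) :=
    Real.rpow_le_rpow_of_nonpos hc (hct k) (by norm_num)
  rw [intervalEnergy]
  linarith [mul_le_mul_of_nonneg_right hlevel hmass,
    mul_nonneg (Real.rpow_nonneg hc.le (-4)) hmass]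

theorem AdaptedPartition.neg_mul_norm_sq_le_halfLineForm (ht : AdaptedPartition α β V t)
    (h : AdmissiblePotential V p ν) {E : ℝ} (hE : 0 < E) (u : 𝓓(halfLine, ℂ))
    (hu : ∀ k, E < (t (k + 1) - t k) ^ (-4 : ℝ) → cauchyData α β (t (k + 1)) u = 0) :
    -E * ‖testToL2 u‖ ^ 2 ≤ halfLineForm α β V u := by
  suffices ‖h.sqrtMul u‖ ^ 2 ≤ 1 * ‖testToL2 (diffOp α β u)‖ ^ 2 + E * ‖testToL2 u‖ ^ 2 by
    rw [h.halfLineForm_eq]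
    linarith
  refine ht.toIsHalfLinePartition.norm_sqrtMul_sq_le h u _ fun k => ?_
  have hmass := integral_norm_sq_nonneg u (ht.lt_succ k).le
  have hlead := integral_norm_sq_nonneg (diffOp α β u) (ht.lt_succ k).le
  rcases lt_or_ge E ((t (k + 1) - t k) ^ (-4 : ℝ)) with hshort | hlong
  · linarith [ht.integral_le_of_cauchyData k u (hu k hshort), mul_nonneg hE.le hmass]
  · have henergy := ht.integral_le k u
    rw [intervalEnergy] at henergy
    linarith [mul_le_mul_of_nonneg_right hlong hmass, mul_nonneg hE.le hmass]

end AdaptedPartition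

section MainEstimates

variable {α β γ p ν : ℝ} {V : ℝ → ℝ}

theorem AdmissiblePotential.exists_adaptedPartition (hα : 0 ≤ α) (hβ : 0 ≤ β) (hν : 0 ≤ ν)
    (hν3 : ν < 3) (hνβ : ν ≤ 2 * β) (h : AdmissiblePotential V p ν) {δ : ℝ} (hδ : 0 < δ) :
    ∃ t : ℕ → ℝ, AdaptedPartition α β V t ∧ (∃ c, 0 < c ∧ ∀ k, c ≤ t (k + 1) - t k) ∧
      ∀ n, ∑ k ∈ Finset.range n, ((t (k + 1) - t k) ^ (4 * p - 1 - ν))⁻¹ ≤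
        ((∫ x in Ioi (0 : ℝ), V x ^ p * x ^ ν) + δ) / massThreshold α β ν p := by
  have hp : 1 ≤ p := h.one_le
  have hνp : ν / p ≤ ν := div_le_self hν hp
  obtain ⟨t, ht, hlength, hmass, hsum⟩ := h.exists_partition (θ := 4 * p - 1 - ν) (by linarith)
    (massThreshold_pos α β (hνp.trans_lt hν3)) hδ
  exact ⟨t, ht.adaptedPartition hα hβ (div_nonneg hν (by linarith)) (hνp.trans_lt hν3)
    (hνp.trans hνβ) h hmass, hlength, hsum⟩

theorem AdmissiblePotential.exists_formModel (hα : 0 ≤ α) (hβ : 0 ≤ β) (hν : 0 ≤ ν)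
    (hν3 : ν < 3) (hνβ : ν ≤ 2 * β) (h : AdmissiblePotential V p ν) :
    ∃ (m : ℝ) (i : 𝓓(halfLine, ℂ) →ₗ[ℂ] graphSpace testToL2 (testToL2 ∘ₗ diffOp α β) h.sqrtMul)
      (π : graphSpace testToL2 (testToL2 ∘ₗ diffOp α β) h.sqrtMul →L[ℂ] L2HalfLine),
      FormModel testToL2 (halfLineForm α β V) m i π := by
  obtain ⟨t, ht, ⟨c, hc, hct⟩, -⟩ := h.exists_adaptedPartition hα hβ hν hν3 hνβ one_pos
  exact ⟨_, _root_.exists_formModel (Real.rpow_nonneg hc.le (-4)) (h.halfLineForm_eq α β)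
    (ht.norm_sqrtMul_sq_le h hc hct) fun _ _ => eq_zero_of_tendsto_diffOp α β⟩

theorem finite_setOf_lt_of_sum_rpow_le {a : ℕ → ℝ} (ha : ∀ k, 0 ≤ a k) (hγ : 0 < γ) {S : ℝ}
    (hS : ∀ n, ∑ k ∈ Finset.range n, a k ^ γ ≤ S) {E : ℝ} (hE : 0 < E) :
    {k | E < a k}.Finite := by
  have hsummable : Summable fun k => a k ^ γ :=
    summable_of_sum_range_le (fun k => Real.rpow_nonneg (ha k) γ) hS
  have hsmall : ∀ᶠ k in cofinite, a k ^ γ < E ^ γ :=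
    hsummable.tendsto_cofinite_zero.eventually_lt_const (Real.rpow_pos_of_pos hE γ)
  refine (eventually_cofinite.1 hsmall).subset fun k hk => ?_
  exact not_lt.2 (Real.rpow_le_rpow hE.le (le_of_lt hk) hγ.le)

theorem AdmissiblePotential.exists_formIndexLE (hα : 0 ≤ α) (hβ : 0 ≤ β) (hν : 0 ≤ ν)
    (hν3 : ν < 3) (hνβ : ν ≤ 2 * β) (hγ : 0 < γ) (h : AdmissiblePotential V (γ + (1 + ν) / 4) ν)
    {δ : ℝ} (hδ : 0 < δ) :
    ∃ a : ℕ → ℝ, (∀ k, 0 ≤ a k) ∧ FormIndexLE testToL2 (halfLineForm α β V) 2 a ∧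
      ∑' k, ENNReal.ofReal (a k ^ γ) ≤
        ENNReal.ofReal ((∫ x in Ioi (0 : ℝ), V x ^ (γ + (1 + ν) / 4) * x ^ ν) /
          massThreshold α β ν (γ + (1 + ν) / 4) + δ) := by
  set p := γ + (1 + ν) / 4 with hp
  have hκ : 0 < massThreshold α β ν p :=
    massThreshold_pos α β ((div_le_self hν h.one_le).trans_lt hν3)
  obtain ⟨t, ht, -, hsum⟩ := h.exists_adaptedPartition hα hβ hν hν3 hνβ (mul_pos hδ hκ)
  rw [add_div, mul_div_cancel_right₀ δ hκ.ne'] at hsum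
  have hlength (k : ℕ) : 0 ≤ t (k + 1) - t k := (sub_pos.2 (ht.lt_succ k)).le
  let a (k : ℕ) : ℝ := (t (k + 1) - t k) ^ (-4 : ℝ)
  have ha (k : ℕ) : 0 ≤ a k := Real.rpow_nonneg (hlength k) _
  have hpow (k : ℕ) : a k ^ γ = ((t (k + 1) - t k) ^ (4 * p - 1 - ν))⁻¹ := by
    rw [← Real.rpow_mul (hlength k), ← Real.rpow_neg (hlength k), hp]
    congr 1
    ring
  simp only [← hpow] at hsum
  have hindex := formIndexLE_of_forall_ker (fun k => cauchyData α β (t (k + 1)))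
    (fun _ hE => finite_setOf_lt_of_sum_rpow_le ha hγ hsum hE)
    fun _ hE u hu => ht.neg_mul_norm_sq_le_halfLineForm h hE u hu
  rw [Module.finrank_prod, Module.finrank_self] at hindex
  refine ⟨a, ha, hindex, ENNReal.tsum_le_of_sum_range_le fun n => ?_⟩
  rw [← ENNReal.ofReal_sum_of_nonneg fun k _ => Real.rpow_nonneg (ha k) γ]
  exact ENNReal.ofReal_le_ofReal (hsum n)

end MainEstimates

end

theorem theorem3 (α β ν γ : ℝ) (hα : 0 ≤ α) (hβ : 0 ≤ β) (hν : 0 ≤ ν) (hν3 : ν < 3)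
    (hνβ : ν ≤ 2 * β) (hγ : (3 - ν) / 4 ≤ γ) :
    ∃ C : ℝ, 0 < C ∧ ∀ V : ℝ → ℝ,
      (∀ᵐ x ∂(volume.restrict (Ioi (0 : ℝ))), 0 ≤ V x) →
      IntegrableOn (fun x => V x ^ (γ + (1 + ν) / 4) * x ^ ν) (Ioi 0) →
      FormSemibounded testToL2 (halfLineForm α β V) ∧
      FormClosable testToL2 (halfLineForm α β V) ∧
      ∃ (Q : Submodule ℂ L2HalfLine) (b : Q →ₗ⋆[ℂ] Q →ₗ[ℂ] ℂ)
        (A : L2HalfLine →ₗ.[ℂ] L2HalfLine),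
        IsFormClosure testToL2 (halfLineForm α β V) Q b ∧
        IsFormOperator Q b A ∧
        IsSelfAdjoint A ∧
        DiscreteNegativeSpectrum A ∧
        traceNegPow A γ ≤
          ENNReal.ofReal (C * ∫ x in Ioi (0 : ℝ), V x ^ (γ + (1 + ν) / 4) * x ^ ν) := by
  have hp : 1 ≤ γ + (1 + ν) / 4 := by linarith
  have hγ0 : 0 < γ := by linarith
  have hκ : 0 < massThreshold α β ν (γ + (1 + ν) / 4) :=
    massThreshold_pos α β ((div_le_self hν hp).trans_lt hν3)
  refine ⟨2 / massThreshold α β ν (γ + (1 + ν) / 4), div_pos two_pos hκ, fun V hV hVint => ?_⟩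
  have h : AdmissiblePotential V (γ + (1 + ν) / 4) ν := ⟨hp, hV, hVint⟩
  obtain ⟨m, i, π, M⟩ := h.exists_formModel hα hβ hν hν3 hνβ
  refine ⟨M.semibounded, M.closable, ?_⟩
  obtain ⟨Q, b, A, hQ, hA, hself, hdiscrete, htrace⟩ :=
    M.exists_formOperator_traceNegPow_le denseRange_testToL2 hγ0
      fun δ hδ => h.exists_formIndexLE hα hβ hν hν3 hνβ hγ0 hδ
  refine ⟨Q, b, A, hQ, hA, hself, hdiscrete, htrace.trans_eq ?_⟩
  rw [div_mul_eq_mul_div, mul_div_assoc, ENNReal.ofReal_mul zero_le_two, ENNReal.ofReal_ofNat,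
    Nat.cast_ofNat]
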